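/- Conventions. Let $B$ be a complete Boolean algebra. In the cut-and-choose game on $B$, player I first plays $p\in B\setminus\{0\}$; in round $n<\omega$ I plays $b_n\in B$ and II answers $r_n\in\{0,1\}$; II wins iff $p\wedge\bigwedge_{r_n=1}b_n-\bigvee_{r_n=0}b_n\neq 0$. In the descending chain game on $B$ the players alternately play nonzero elements $b_0\ge c_0\ge b_1\ge c_1\ge\cdots$ of $B$ (I plays the $b_n$, II the $c_n$), and II wins iff $\bigwedge_n b_n\ne 0$. "II wins a game" means that II has a winning strategy. The density of $B$ is the least size of a dense subset of $B\setminus\{0\}$. Balanced trees and codings. Let $\mathcal T$ be the set of countable trees $T$ whose nodes are countable ordinals, such that for every $x\in T$ and every $\gamma<\mathrm{height}(T)$ some node on level $\gamma$ of $T$ is comparable with $x$. Write $T\restriction\beta$ for the tree of all nodes of $T$ of level less than $\beta$. A coding is a function $f:\mathcal T\to\mathcal T$ such that $\mathrm{height}(f(T))=\mathrm{height}(T)+1$ and $f(T)\restriction\mathrm{height}(T)=T$ for all $T\in\mathcal T$. The forcing. Let $\kappa$ be a cardinal, $S\subseteq\{\alpha<\kappa:\mathrm{cf}(\alpha)=\omega\}$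 and $f$ a coding. Let $Q_0=Q_0(S,f)$ be the set of pairs $(g,T)$ such that for some $\alpha<\omega_1$, $g:\alpha\to\kappa$ is increasing and continuous, $T\in\mathcal T$ has height $\alpha$, and for all $\beta<\alpha$, if $g(\beta)\in S$ then $T\restriction(\beta+1)=f(T\restriction\beta)$. Put $(g',T')\le(g,T)$ iff $g'\supseteq g$ and $T'\restriction\mathrm{height}(T)=T$. Let $\dot R$ be the $Q_0$-name for the union of the trees appearing in the generic filter. Let $P(S,f)$ be the two-step iteration of $Q_0$ and $\dot R$ (larger nodes being stronger conditions), represented by the triples $(g,T,x)$ with $(g,T)\in Q_0$ and $x\in T$, where $(g',T',x')\le(g,T,x)$ iff $(g',T')\le(g,T)$ and $x\le_{T'}x'$. Let $B(S,f)$ be the complete Boolean algebra of regular open subsets of $P(S,f)$. Statement. Let $\kappa$ be a measurable cardinal. Then there exist a coding $f$ and a set $S\subseteq\{\alpha<\kappa:\mathrm{cf}(\alpha)=\omega\}$ such that both $S$ and $\{\alpha<\kappa:\mathrm{cf}(\alpha)=\omega\}\setminus S$ are stationary in $\kappa$. For every such $S$ and every coding $f$: $Q_0(S,f)$ is $\sigma$-closed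 and forces that $\dot R$ is a Souslin tree; $B(S,f)$ is proper and has density $\kappa$; II wins the cut-and-choose game on $B(S,f)$; and II does not win the descending chain game on $B(S,f)$. In particular, there is a proper complete Boolean algebra of density $\kappa$ on which II wins the cut-and-choose game but does not win the descending chain game. -/

import Mathlib

universe u

open Cardinal Ordinal

namespace CutChoose

/-! ### Measurable cardinals -/

/-- `κ` is measurable: it is uncountable and carries a nonprincipal `κ`-complete ultrafilter. -/
def IsMeasurableCardinal (κ : Cardinal.{u}) : Prop :=
  ℵ₀ < κ ∧ ∃ U : Ultrafilter κ.ord.ToType,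
    (∀ x, ({x} : Set κ.ord.ToType) ∉ U) ∧
      CardinalInterFilter (U : Filter κ.ord.ToType) κ

/-- `S` is a set of ordinals below `κ` of countable cofinality such that both `S` and its
complement within the ordinals of countable cofinality are stationary in `κ`. -/
def IsStatCostat {κ : Cardinal.{u}} (S : Set κ.ord.ToType) : Prop :=
  S ⊆ {α | Order.cof (Set.Iio α) = ℵ₀} ∧
    IsStationary S ∧ IsStationary ({α | Order.cof (Set.Iio α) = ℵ₀} \ S)

/-! ### Complete Boolean algebras: density, properness, games -/

section BooleanAlgebra

universe v

variable (B : Type v) [CompleteBooleanAlgebra B]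

/-- `D` is a dense set of nonzero elements of `B`. -/
def IsDenseSet {B : Type v} [CompleteBooleanAlgebra B] (D : Set B) : Prop :=
  (∀ d ∈ D, d ≠ ⊥) ∧ ∀ b : B, b ≠ ⊥ → ∃ d ∈ D, d ≤ b

/-- The density of `B`: the least size of a dense subset of `B`. -/
noncomputable def density : Cardinal.{v} :=
  sInf {c | ∃ D : Set B, IsDenseSet D ∧ #D = c}

/-- `C` is a closed unbounded family of countable subsets of `X`. -/
structure IsClubOfCountable {X : Type v} (C : Set (Set X)) : Prop where
  countable : ∀ N ∈ C, N.Countable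
  unbounded : ∀ M : Set X, M.Countable → ∃ N ∈ C, M ⊆ N
  closed : ∀ N : ℕ → Set X, Monotone N → (∀ n, N n ∈ C) → (⋃ n, N n) ∈ C

/-- `q` is generic over `N`, where `N` is a set whose members are elements of `B` and subsets of
`B`: for every dense `D ∈ N`, the set `D ∩ N` is predense below `q`. -/
def IsGenericOver {B : Type v} [CompleteBooleanAlgebra B] (N : Set (B ⊕ Set B)) (q : B) : Prop :=
  ∀ D : Set B, Sum.inr D ∈ N → IsDenseSet D →
    ∀ r ≤ q, r ≠ ⊥ → ∃ d ∈ D, Sum.inl d ∈ N ∧ d ⊓ r ≠ ⊥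

/-- `B` is proper: for club many countable `N`, every nonzero `p ∈ N` has a nonzero `q ≤ p` that is
generic over `N`. Genericity over a countable elementary submodel of some `H(θ)` only involves the
elements and the subsets of `B` that lie in the model, so `N` ranges over countable sets of
elements and subsets of `B`. -/
def IsProper : Prop :=
  ∃ C : Set (Set (B ⊕ Set B)), IsClubOfCountable C ∧
    ∀ N ∈ C, ∀ p : B, p ≠ ⊥ → Sum.inl p ∈ N →
      ∃ q ≤ p, q ≠ ⊥ ∧ IsGenericOver N q

/-- The sequence of moves `b 0, …, b n`. -/
def movesUpTo {B : Type v} (b : ℕ → B) (n : ℕ) : List B :=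
  List.ofFn fun i : Fin (n + 1) => b i

/-- Player II has a winning strategy in the cut-and-choose game on `B`. Player I chooses a nonzero
`p` and then elements `b 0, b 1, …`; after the move `b n` player II answers
`r n ∈ {true, false}`, knowing `p` and `b 0, …, b n`. Player II wins if
`p ∧ ⋀ {b n | r n = true} - ⋁ {b n | r n = false}` is nonzero. -/
def WinsCutAndChoose : Prop :=
  ∃ σ : B → List B → Bool, ∀ p : B, p ≠ ⊥ → ∀ b : ℕ → B,
    (p ⊓ ⨅ n ∈ {n | σ p (movesUpTo b n) = true}, b n) \
      (⨆ n ∈ {n | σ p (movesUpTo b n) = false}, b n) ≠ ⊥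

/-- Player II has a winning strategy in the descending chain game on `B`. The players play nonzero
elements `b 0 ≥ c 0 ≥ b 1 ≥ c 1 ≥ …`, player I playing the `b n` and player II the `c n`.
Player II wins if `⋀ b n` is nonzero. A winning strategy has to give a legal answer at every finite
position in which player I has moved legally, and has to win every infinite run. -/
def WinsDescendingChain : Prop :=
  ∃ σ : List B → B,
    (∀ (b : ℕ → B) (n : ℕ), (∀ i ≤ n, b i ≠ ⊥) →
      (∀ i < n, b (i + 1) ≤ σ (movesUpTo b i)) →
        σ (movesUpTo b n) ≤ b n ∧ σ (movesUpTo b n) ≠ ⊥) ∧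
    (∀ b : ℕ → B, (∀ i, b i ≠ ⊥) → (∀ i, b (i + 1) ≤ σ (movesUpTo b i)) → ⨅ i, b i ≠ ⊥)

end BooleanAlgebra

/-! ### The regular open algebra -/

section RegularOpen

universe v

/-- The regular elements of a frame form a complete Boolean algebra. -/
noncomputable instance regularCompleteBooleanAlgebra (α : Type v) [Order.Frame α] :
    CompleteBooleanAlgebra (Heyting.Regular α) where
  __ := (inferInstance : BooleanAlgebra (Heyting.Regular α))
  sSup s := Heyting.Regular.toRegular (⨆ a ∈ s, (a : α))
  sInf s := Heyting.Regular.toRegular (⨅ a ∈ s, (a : α))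
  isLUB_sSup s := by
    refine ⟨fun a ha => ?_, fun b hb => ?_⟩
    · have h : (a : α) ≤ ⨆ a ∈ s, (a : α) :=
        le_iSup₂ (f := fun (a : Heyting.Regular α) (_ : a ∈ s) => (a : α)) a ha
      exact Heyting.Regular.coe_le_coe.1 (h.trans le_compl_compl)
    · refine (Heyting.Regular.gi.gc _ _).2 (iSup₂_le fun a ha => ?_)
      exact Heyting.Regular.coe_le_coe.2 (hb ha)
  isGLB_sInf s := by
    refine ⟨fun a ha => ?_, fun b hb => ?_⟩
    · exact (Heyting.Regular.gi.gc _ _).2 (iInf₂_le a ha)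
    · refine Heyting.Regular.coe_le_coe.1 (le_trans ?_ le_compl_compl)
      exact le_iInf₂ fun a ha => Heyting.Regular.coe_le_coe.2 (hb ha)

/-- The algebra of regular open subsets of a forcing notion `P` (smaller conditions are stronger);
the open sets are the downward closed ones. -/
abbrev RegularOpenAlgebra (P : Type v) [Preorder P] : Type v :=
  Heyting.Regular (LowerSet P)

end RegularOpen

/-! ### Forcing notions -/

section Forcing

universe v w

variable {Q : Type v} [Preorder Q]

/-- `Q` is `σ`-closed: every descending sequence of conditions has a lower bound. -/
def IsSigmaClosed (Q : Type v) [Preorder Q] : Prop :=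
  ∀ p : ℕ → Q, Antitone p → ∃ q, ∀ n, q ≤ p n

/-- A `Q`-name for a subset of a ground model set `I`: the pairs `(i, s)` with `s ∈ A i`. -/
def SubsetName (Q : Type v) (I : Type w) : Type max v w := I → Set Q

/-- `p` forces that `i` belongs to the set named by `A`. -/
def ForcesMem {I : Type w} (p : Q) (i : I) (A : SubsetName Q I) : Prop :=
  ∀ q ≤ p, ∃ r ≤ q, ∃ s ∈ A i, r ≤ s

/-- `p` forces that the set named by `A` is countable, in that it is covered by a ground model
countable set. (Over a `σ`-closed forcing this is the same as being countable.) -/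
def ForcesCountable {I : Type w} (p : Q) (A : SubsetName Q I) : Prop :=
  ∀ q ≤ p, ∃ r ≤ q, ∃ C : Set I, C.Countable ∧ ∀ s ≤ r, ∀ i, ForcesMem s i A → i ∈ C

end Forcing

/-! ### Trees on countable ordinals -/

/-- The set `ω₁` of countable ordinals. -/
abbrev Omega1 : Type u := (ω₁ : Ordinal.{u}).ToType

/-- A countable tree whose nodes are countable ordinals: a strict partial order on a countable
subset of `ω₁` in which the predecessors of each node are well-ordered. -/
@[ext]
structure CTree where
  carrier : Set Omega1.{u}
  countable : carrier.Countable
  lt : Omega1.{u} → Omega1.{u} → Prop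
  mem_of_lt : ∀ {x y}, lt x y → x ∈ carrier ∧ y ∈ carrier
  lt_trans : ∀ {x y z}, lt x y → lt y z → lt x z
  wf : WellFounded lt
  linear : ∀ {x y z}, lt x z → lt y z → x = y ∨ lt x y ∨ lt y x

namespace CTree

instance isWellFounded (T : CTree.{u}) : IsWellFounded Omega1.{u} T.lt := ⟨T.wf⟩

/-- The level of a node: the order type of the set of its predecessors, which for a tree
is its rank in the tree order. -/
noncomputable def level (T : CTree.{u}) (x : Omega1.{u}) : Ordinal.{u} :=
  IsWellFounded.rank T.lt x

theorem level_lt (T : CTree.{u}) {x y : Omega1.{u}} (h : T.lt x y) : T.level x < T.level y :=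
  IsWellFounded.rank_lt_of_rel h

/-- The height of `T`: the least ordinal above the levels of all nodes. -/
noncomputable def height (T : CTree.{u}) : Ordinal.{u} :=
  sInf {β | ∀ x ∈ T.carrier, T.level x < β}

theorem level_lt_height (T : CTree.{u}) {x : Omega1.{u}} (hx : x ∈ T.carrier) :
    T.level x < T.height := by
  have hne : {β | ∀ x ∈ T.carrier, T.level x < β}.Nonempty :=
    ⟨⨆ x : Omega1.{u}, Order.succ (T.level x), fun x _ =>
      (Order.lt_succ _).trans_le (Ordinal.le_iSup (fun x => Order.succ (T.level x)) x)⟩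
  exact csInf_mem hne x hx

/-- `T` restricted to `β`: the nodes of level less than `β`, with the inherited ordering. -/
def restrict (T : CTree.{u}) (β : Ordinal.{u}) : CTree.{u} where
  carrier := {x | x ∈ T.carrier ∧ T.level x < β}
  countable := T.countable.mono fun _ h => h.1
  lt x y := T.lt x y ∧ T.level y < β
  mem_of_lt h := ⟨⟨(T.mem_of_lt h.1).1, (T.level_lt h.1).trans h.2⟩, (T.mem_of_lt h.1).2, h.2⟩
  lt_trans h h' := ⟨T.lt_trans h.1 h'.1, h'.2⟩
  wf := Subrelation.wf (fun h => h.1) T.wf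
  linear h h' := by
    rcases T.linear h.1 h'.1 with h₁ | h₁ | h₁
    · exact Or.inl h₁
    · exact Or.inr (Or.inl ⟨h₁, (T.level_lt h'.1).trans h'.2⟩)
    · exact Or.inr (Or.inr ⟨h₁, (T.level_lt h.1).trans h.2⟩)

theorem level_restrict (T : CTree.{u}) (β : Ordinal.{u}) (x : Omega1.{u}) (hx : T.level x < β) :
    (T.restrict β).level x = T.level x := by
  induction x using T.wf.induction with
  | _ x ih =>
    have key : ∀ (T' : CTree.{u}), T'.level x =
        ⨆ y : {y // T'.lt y x}, Order.succ (T'.level y) := fun T' =>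
      IsWellFounded.rank_eq T'.lt x
    rw [key, key T]
    have e : ∀ y, (T.restrict β).lt y x ↔ T.lt y x := fun y => ⟨fun h => h.1, fun h => ⟨h, hx⟩⟩
    refine (Equiv.subtypeEquivRight e).iSup_congr fun y => ?_
    have hy : T.lt y.1 x := y.2.1
    simp only [Equiv.subtypeEquivRight_apply_coe]
    rw [ih y.1 hy ((T.level_lt hy).trans hx)]

theorem restrict_restrict (T : CTree.{u}) {α β : Ordinal.{u}} (h : β ≤ α) :
    (T.restrict α).restrict β = T.restrict β := by
  ext x y
  · constructor
    · rintro ⟨⟨h₁, h₂⟩, h₃⟩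
      exact ⟨h₁, by rwa [level_restrict T α x h₂] at h₃⟩
    · rintro ⟨h₁, h₂⟩
      exact ⟨⟨h₁, h₂.trans_le h⟩, by rwa [level_restrict T α x (h₂.trans_le h)]⟩
  · constructor
    · rintro ⟨⟨h₁, h₂⟩, h₃⟩
      exact ⟨h₁, by rwa [level_restrict T α y h₂] at h₃⟩
    · rintro ⟨h₁, h₂⟩
      exact ⟨⟨h₁, h₂.trans_le h⟩, by rwa [level_restrict T α y (h₂.trans_le h)]⟩

theorem restrict_height (T : CTree.{u}) : T.restrict T.height = T := by
  ext x y
  · exact ⟨fun h => h.1, fun h => ⟨h, T.level_lt_height h⟩⟩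
  · exact ⟨fun h => h.1, fun h => ⟨h, T.level_lt_height (T.mem_of_lt h).2⟩⟩

/-- Every node of `T` is comparable with some node at every level below the height of `T`. -/
def IsBalanced (T : CTree.{u}) : Prop :=
  ∀ x ∈ T.carrier, ∀ γ < T.height, ∃ y ∈ T.carrier, T.level y = γ ∧ (T.lt y x ∨ y = x ∨ T.lt x y)

end CTree

/-- `f` assigns to every balanced tree `T` a balanced end-extension with exactly one more level.
(The values of `f` at other trees are irrelevant.) -/
def IsCoding (f : CTree.{u} → CTree.{u}) : Prop :=
  ∀ T : CTree.{u}, T.IsBalanced →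
    (f T).IsBalanced ∧ (f T).height = Order.succ T.height ∧ (f T).restrict T.height = T

/-! ### The forcing -/

/-- The forcing `Q₀`: pairs `(g, T)` such that `g : α → κ` for some `α < ω₁` is increasing and
continuous, `T` is a balanced countable tree of height `α`, and for all `β < α`, if `g β ∈ S` then
the `β`-th level of `T` is the one prescribed by `f`. -/
structure QZero {κ : Cardinal.{u}} (S : Set κ.ord.ToType) (f : CTree.{u} → CTree.{u}) where
  length : Ordinal.{u}
  length_lt : length < ω₁
  g : Set.Iio length → κ.ord.ToType
  g_strictMono : StrictMono g
  g_continuous : ∀ β : Set.Iio length, Order.IsSuccLimit (β : Ordinal.{u}) →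
    IsLUB (g '' Set.Iio β) (g β)
  tree : CTree.{u}
  balanced : tree.IsBalanced
  height_eq : tree.height = length
  coded : ∀ β : Set.Iio length, g β ∈ S →
    tree.restrict (Order.succ (β : Ordinal.{u})) = f (tree.restrict (β : Ordinal.{u}))

section Poset

variable {κ : Cardinal.{u}} {S : Set κ.ord.ToType} {f : CTree.{u} → CTree.{u}}

/-- Coordinatewise extension: `g` is extended as a function and `T` is end-extended. -/
instance QZero.preorder : Preorder (QZero S f) where
  le p q := ∃ h : q.length ≤ p.length,
    (∀ β : Set.Iio q.length, p.g ⟨β, lt_of_lt_of_le β.2 h⟩ = q.g β) ∧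
      p.tree.restrict q.length = q.tree
  le_refl p := ⟨le_rfl, fun _ => rfl, by rw [← p.height_eq, CTree.restrict_height]⟩
  le_trans p q r := by
    rintro ⟨h₁, h₂, h₃⟩ ⟨k₁, k₂, k₃⟩
    refine ⟨k₁.trans h₁, fun β => ?_, ?_⟩
    · rw [← k₂ β, ← h₂]
    · rw [← k₃, ← h₃, CTree.restrict_restrict _ k₁]

theorem QZero.lt_of_le {p q : QZero S f} (h : p ≤ q) {x y : Omega1.{u}} (hxy : q.tree.lt x y) :
    p.tree.lt x y := by
  obtain ⟨_, _, h⟩ := h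
  rw [← h] at hxy
  exact hxy.1

/-- The name for the union `R` of the trees that appear in the generic filter of `Q₀`. -/
def treeName (S : Set κ.ord.ToType) (f : CTree.{u} → CTree.{u}) :
    SubsetName (QZero S f) Omega1.{u} :=
  fun x => {q | x ∈ q.tree.carrier}

/-- The name for the ordering of `R`. -/
def treeOrderName (S : Set κ.ord.ToType) (f : CTree.{u} → CTree.{u}) :
    SubsetName (QZero S f) (Omega1.{u} × Omega1.{u}) :=
  fun x => {q | q.tree.lt x.1 x.2}

/-- `p` forces that `A` is a subset of `R`. -/
def ForcesSubsetTree (p : QZero S f) (A : SubsetName (QZero S f) Omega1.{u}) : Prop :=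
  ∀ q ≤ p, ∀ x, ForcesMem q x A → ForcesMem q x (treeName S f)

/-- `p` forces that `A` is an antichain of `R`. -/
def ForcesAntichain (p : QZero S f) (A : SubsetName (QZero S f) Omega1.{u}) : Prop :=
  ForcesSubsetTree p A ∧ ∀ q ≤ p, ∀ x y, ForcesMem q x A → ForcesMem q y A →
    ¬ ForcesMem q (x, y) (treeOrderName S f)

/-- `p` forces that `A` is a chain of `R`. -/
def ForcesChain (p : QZero S f) (A : SubsetName (QZero S f) Omega1.{u}) : Prop :=
  ForcesSubsetTree p A ∧ ∀ q ≤ p, ∀ x y, ForcesMem q x A → ForcesMem q y A → x ≠ y →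
    ∃ r ≤ q, ForcesMem r (x, y) (treeOrderName S f) ∨ ForcesMem r (y, x) (treeOrderName S f)

/-- `Q₀` forces that `R` is a Souslin tree: it has height `ω₁`, and all its antichains and all its
chains are countable. (Conditions have countable height and are end-extended by stronger
conditions, so `R` is a tree and its height is `ω₁` once every countable ordinal is exceeded.) -/
def ForcesSouslinTree (S : Set κ.ord.ToType) (f : CTree.{u} → CTree.{u}) : Prop :=
  (∀ (p : QZero S f) (α : Ordinal.{u}), α < ω₁ → ∃ q ≤ p, α < q.tree.height) ∧
    (∀ (p : QZero S f) (A : SubsetName (QZero S f) Omega1.{u}),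
      ForcesAntichain p A → ForcesCountable p A) ∧
    (∀ (p : QZero S f) (A : SubsetName (QZero S f) Omega1.{u}),
      ForcesChain p A → ForcesCountable p A)

variable (S f) in
/-- The two-step iteration of `Q₀` and the generic tree `R`, in the form of its dense set of
conditions `(g, T, x)` with `(g, T) ∈ Q₀` and `x` a node of `T`. -/
structure CodedSouslin where
  base : QZero S f
  node : Omega1.{u}
  node_mem : node ∈ base.tree.carrier

/-- `(g', T', x') ≤ (g, T, x)` iff `(g', T') ≤ (g, T)` in `Q₀` and `x'` is equal to `x` or above
`x` in `T'`. -/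
instance CodedSouslin.preorder : Preorder (CodedSouslin S f) where
  le p q := p.base ≤ q.base ∧ (q.node = p.node ∨ p.base.tree.lt q.node p.node)
  le_refl p := ⟨le_rfl, Or.inl rfl⟩
  le_trans p q r := by
    rintro ⟨h₁, h₂⟩ ⟨k₁, k₂⟩
    refine ⟨h₁.trans k₁, ?_⟩
    rcases k₂ with k₂ | k₂
    · rwa [k₂]
    · have k₃ := QZero.lt_of_le h₁ k₂
      rcases h₂ with h₂ | h₂
      · exact Or.inr (h₂ ▸ k₃)
      · exact Or.inr (p.base.tree.lt_trans k₃ h₂)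

end Poset

end CutChoose

open CutChoose

/-!
The forcing `Q₀` is `σ`-closed because the union of a descending sequence of conditions is a
condition (`QZero.exists_limit`). What can be added on top of such a union is governed by the
supremum `γ` of the values of `g`: if `γ ∉ S`, the next level of the tree may be any level that
keeps the tree balanced, and if `γ ∈ S`, the next level is the one given by `f`. By
`IsRegularUncountable.exists_run`, a construction of length `ω` can be arranged in such a way that
`γ` falls into any prescribed stationary set of points of countable cofinality. The Souslin
property, properness and the two results on games all follow from this.

* With `γ ∉ S`, every dense set of pairs `(q, x)` can be sealed: it contains all pairs `(r, x)` for
  which `x` is on a certain level of a certain `r ≤ q` (`exists_sealed`). If this is applied to the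
  pairs that decide whether an antichain has an element comparable with an extension of `x`, and to
  the pairs that forbid that a chain has an element above `x`, it bounds the antichains and the
  chains of the generic tree, which is therefore Souslin. For properness, sealing the dense sets in
  a countable `N` one after the other by conditions that only depend on finitely many members of `N`
  produces a condition that is generic over `N` (`isProper`).
* In the cut-and-choose game, player II imagines conditions indexed by finite sequences of ordinals
  below `κ` that decide the moves of player I, and answers as almost all of them do in the sense of
  a countably complete ultrafilter on `κ`. The sequences along which the conditions agree with all
  answers form a tree that branches unboundedly, so there is a branch along which `γ ∉ S`, and then
  the conditions along the branch have a lower bound (`winsCutAndChoose`).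
* In the descending chain game, a strategy of player II is confronted with a binary tree of plays
  that share one descending sequence in `Q₀` but in which the nodes of the generic tree are
  incompatible. With `γ ∈ S`, a play that player II wins needs an upper bound of its nodes on the
  level given by `f`. This level is countable, and there are uncountably many plays
  (`not_winsDescendingChain`).

Measurability enters through the ultrafilter, and in the computation of the density through the
fact that `κ` is a strong limit cardinal.
-/
namespace CutChoose

/-! ### Countable trees and their end-extensions -/

namespace CTree

variable {T T' : CTree.{u}} {x y z : Omega1.{u}} {β γ : Ordinal.{u}}

theorem lt_irrefl (T : CTree.{u}) (x : Omega1.{u}) : ¬ T.lt x x :=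
  fun h => (T.level_lt h).false

/-- The reflexive closure of the tree ordering. -/
def le (T : CTree.{u}) (x y : Omega1.{u}) : Prop := x = y ∨ T.lt x y

theorem le_refl (T : CTree.{u}) (x : Omega1.{u}) : T.le x x := Or.inl rfl

theorem le_trans (h : T.le x y) (h' : T.le y z) : T.le x z := by
  rcases h with rfl | h
  · exact h'
  · rcases h' with rfl | h'
    · exact Or.inr h
    · exact Or.inr (T.lt_trans h h')

theorem lt_of_le_of_lt (h : T.le x y) (h' : T.lt y z) : T.lt x z := by
  rcases h with rfl | h
  · exact h'
  · exact T.lt_trans h h'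

theorem mem_of_le (h : T.le x y) (hy : y ∈ T.carrier) : x ∈ T.carrier := by
  rcases h with rfl | h
  · exact hy
  · exact (T.mem_of_lt h).1

theorem mem_of_le' (h : T.le x y) (hx : x ∈ T.carrier) : y ∈ T.carrier := by
  rcases h with rfl | h
  · exact hx
  · exact (T.mem_of_lt h).2

theorem level_le (h : T.le x y) : T.level x ≤ T.level y := by
  rcases h with rfl | h
  · exact le_rfl
  · exact (T.level_lt h).le

theorem linear_le (h : T.le x z) (h' : T.le y z) : T.le x y ∨ T.le y x := by
  rcases h with rfl | h
  · exact Or.inr h'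
  · rcases h' with rfl | h'
    · exact Or.inl (Or.inr h)
    · rcases T.linear h h' with h | h | h
      · exact Or.inl (Or.inl h)
      · exact Or.inl (Or.inr h)
      · exact Or.inr (Or.inr h)

theorem level_eq_iSup (T : CTree.{u}) (x : Omega1.{u}) :
    T.level x = ⨆ y : {y // T.lt y x}, Order.succ (T.level y) :=
  IsWellFounded.rank_eq T.lt x

theorem exists_lt_level_eq (h : γ < T.level x) : ∃ y, T.lt y x ∧ T.level y = γ := by
  induction x using T.wf.induction with
  | _ x ih =>
    rw [level_eq_iSup, Ordinal.lt_iSup_iff] at h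
    obtain ⟨⟨y, hy⟩, h⟩ := h
    rcases (Order.lt_succ_iff.1 h).eq_or_lt with rfl | h
    · exact ⟨y, hy, rfl⟩
    · obtain ⟨z, hz, e⟩ := ih y hy h
      exact ⟨z, T.lt_trans hz hy, e⟩

theorem exists_le_level_eq (h : γ ≤ T.level x) : ∃ y, T.le y x ∧ T.level y = γ := by
  rcases h.eq_or_lt with rfl | h
  · exact ⟨x, T.le_refl x, rfl⟩
  · obtain ⟨y, hy, e⟩ := exists_lt_level_eq h
    exact ⟨y, Or.inr hy, e⟩

theorem lt_of_le_of_level_lt (hx : T.le x z) (hy : T.le y z) (h : T.level x < T.level y) :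
    T.lt x y := by
  rcases linear_le hx hy with (rfl | h') | h'
  · exact (h.false).elim
  · exact h'
  · exact ((level_le h').not_gt h).elim

/-- The level of a node only depends on its predecessors. -/
theorem level_eq_of_initial (h : ∀ x ∈ T.carrier, ∀ y, T'.lt y x ↔ T.lt y x) :
    ∀ x ∈ T.carrier, T'.level x = T.level x := by
  intro x
  induction x using T.wf.induction with
  | _ x ih =>
    intro hx
    rw [level_eq_iSup, level_eq_iSup]
    refine (Equiv.subtypeEquivRight (h x hx)).iSup_congr fun y => ?_
    have hy : T.lt y.1 x := (h x hx _).1 y.2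
    simp only [Equiv.subtypeEquivRight_apply_coe]
    rw [ih y.1 hy (T.mem_of_lt hy).1]

theorem height_le_iff : T.height ≤ β ↔ ∀ x ∈ T.carrier, T.level x < β :=
  ⟨fun h _ hx => (T.level_lt_height hx).trans_le h, fun h => csInf_le' h⟩

theorem exists_mem_level_eq (h : γ < T.height) : ∃ x ∈ T.carrier, T.level x = γ := by
  have h' := h.not_ge
  rw [height_le_iff] at h'
  push Not at h'
  obtain ⟨x, hx, hγ⟩ := h'
  obtain ⟨y, hy, e⟩ := exists_le_level_eq hγ
  exact ⟨y, mem_of_le hy hx, e⟩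

theorem countable_Iio_height (T : CTree.{u}) : (Set.Iio T.height).Countable := by
  refine (T.countable.image T.level).mono fun γ hγ => ?_
  obtain ⟨x, hx, e⟩ := exists_mem_level_eq hγ
  exact ⟨x, hx, e⟩

theorem height_restrict (h : β ≤ T.height) : (T.restrict β).height = β := by
  apply le_antisymm
  · rw [height_le_iff]
    intro x hx
    rw [level_restrict _ _ _ hx.2]
    exact hx.2
  · refine le_of_forall_lt fun γ hγ => ?_
    obtain ⟨x, hx, e⟩ := exists_mem_level_eq (hγ.trans_le h)
    subst e
    rw [← level_restrict T β x hγ]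
    exact level_lt_height _ ⟨hx, hγ⟩

theorem IsBalanced.restrict (hT : T.IsBalanced) (h : β ≤ T.height) :
    (T.restrict β).IsBalanced := by
  intro x hx γ hγ
  rw [height_restrict h] at hγ
  obtain ⟨y, hy, e, hxy⟩ := hT x hx.1 γ (hγ.trans_le h)
  have hyβ : T.level y < β := e ▸ hγ
  refine ⟨y, ⟨hy, hyβ⟩, by rw [level_restrict _ _ _ hyβ, e], ?_⟩
  rcases hxy with h | h | h
  · exact Or.inl ⟨h, hx.2⟩
  · exact Or.inr (Or.inl h)
  · exact Or.inr (Or.inr ⟨h, hyβ⟩)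

theorem IsBalanced.exists_le (hT : T.IsBalanced) (hx : x ∈ T.carrier) (h : γ < T.height) :
    ∃ y ∈ T.carrier, T.le x y ∧ γ ≤ T.level y := by
  obtain ⟨y, hy, e, h | h | h⟩ := hT x hx γ h
  · exact ⟨x, hx, T.le_refl x, e ▸ (T.level_lt h).le⟩
  · exact ⟨y, hy, Or.inl h.symm, e.ge⟩
  · exact ⟨y, hy, Or.inr h, e.ge⟩

/-- `T'` is an end-extension of `T`: the part of `T'` below the height of `T` is `T`. -/
def EndExt (T T' : CTree.{u}) : Prop := T'.restrict T.height = T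

theorem EndExt.mem_iff (h : EndExt T T') :
    x ∈ T.carrier ↔ x ∈ T'.carrier ∧ T'.level x < T.height := by
  conv_lhs => rw [← h]
  rfl

theorem EndExt.mem (h : EndExt T T') (hx : x ∈ T.carrier) : x ∈ T'.carrier := (h.mem_iff.1 hx).1

theorem EndExt.lt_iff (h : EndExt T T') : T.lt x y ↔ T'.lt x y ∧ T'.level y < T.height := by
  conv_lhs => rw [← h]
  rfl

theorem EndExt.lt_iff' (h : EndExt T T') (hy : y ∈ T.carrier) : T'.lt x y ↔ T.lt x y := by
  rw [h.lt_iff, and_iff_left (h.mem_iff.1 hy).2]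

theorem EndExt.le_iff (h : EndExt T T') (hy : y ∈ T.carrier) : T'.le x y ↔ T.le x y := by
  rw [le, le, h.lt_iff' hy]

theorem EndExt.le_of_le (h : EndExt T T') (hy : T.le x y) : T'.le x y := by
  rcases hy with hy | hy
  · exact Or.inl hy
  · exact Or.inr (h.lt_iff.1 hy).1

theorem EndExt.level_eq (h : EndExt T T') (hx : x ∈ T.carrier) : T'.level x = T.level x :=
  level_eq_of_initial (fun _ hx _ => h.lt_iff' hx) x hx

/-! ### Unions of chains of end-extensions -/

section Union

variable {C : ℕ → CTree.{u}} (hC : ∀ m n, m ≤ n → EndExt (C m) (C n))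

include hC in
theorem lt_iff_of_chain {m n : ℕ} (hy : y ∈ (C m).carrier) (h : (C n).lt x y) : (C m).lt x y := by
  rcases le_total m n with hmn | hmn
  · exact ((hC m n hmn).lt_iff' hy).1 h
  · exact ((hC n m hmn).lt_iff.1 h).1

/-- The union of a chain of end-extensions. -/
def union (C : ℕ → CTree.{u}) (hC : ∀ m n, m ≤ n → EndExt (C m) (C n)) : CTree.{u} where
  carrier := ⋃ n, (C n).carrier
  countable := Set.countable_iUnion fun n => (C n).countable
  lt x y := ∃ n, (C n).lt x y
  mem_of_lt := fun ⟨n, h⟩ =>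
    ⟨Set.mem_iUnion.2 ⟨n, ((C n).mem_of_lt h).1⟩, Set.mem_iUnion.2 ⟨n, ((C n).mem_of_lt h).2⟩⟩
  lt_trans := by
    rintro x y z ⟨m, h⟩ ⟨n, h'⟩
    have := lt_iff_of_chain hC ((C n).mem_of_lt h').1 h
    exact ⟨n, (C n).lt_trans this h'⟩
  wf := by
    refine ⟨fun x => ⟨x, fun y ⟨n, hy⟩ => ?_⟩⟩
    have : ∀ y ∈ (C n).carrier, Acc (fun x y => ∃ n, (C n).lt x y) y := by
      intro y
      induction y using (C n).wf.induction with
      | _ y ih =>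
        intro hy
        refine ⟨y, fun z ⟨m, hz⟩ => ?_⟩
        have hz' := lt_iff_of_chain hC hy hz
        exact ih z hz' ((C n).mem_of_lt hz').1
    exact this y ((C n).mem_of_lt hy).1
  linear := by
    rintro x y z ⟨m, h⟩ ⟨n, h'⟩
    have := lt_iff_of_chain hC ((C n).mem_of_lt h').2 h
    rcases (C n).linear this h' with h | h | h
    · exact Or.inl h
    · exact Or.inr (Or.inl ⟨n, h⟩)
    · exact Or.inr (Or.inr ⟨n, h⟩)

theorem level_union {n : ℕ} (hx : x ∈ (C n).carrier) : (union C hC).level x = (C n).level x :=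
  by
  refine level_eq_of_initial (T := C n) (T' := union C hC)
    (fun _ hx _ => ⟨?_, fun h => ⟨n, h⟩⟩) x hx
  rintro ⟨_, h⟩
  exact lt_iff_of_chain hC hx h

theorem endExt_union (n : ℕ) : EndExt (C n) (union C hC) := by
  have key : ∀ x ∈ (union C hC).carrier, (union C hC).level x < (C n).height →
      x ∈ (C n).carrier := by
    intro x hx hl
    obtain ⟨m, hm⟩ := Set.mem_iUnion.1 hx
    rcases le_total m n with hmn | hmn
    · exact (hC m n hmn).mem hm
    · rw [level_union hC hm] at hl
      exact (hC n m hmn).mem_iff.2 ⟨hm, hl⟩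
  have hl : ∀ x ∈ (C n).carrier, (union C hC).level x < (C n).height := by
    intro x hx
    rw [level_union hC hx]
    exact level_lt_height _ hx
  ext x y
  · exact ⟨fun h => key x h.1 h.2, fun h => ⟨Set.mem_iUnion.2 ⟨n, h⟩, hl x h⟩⟩
  · constructor
    · rintro ⟨⟨m, h⟩, h'⟩
      exact lt_iff_of_chain hC (key y (Set.mem_iUnion.2 ⟨m, ((C m).mem_of_lt h).2⟩) h') h
    · exact fun h => ⟨⟨n, h⟩, hl y ((C n).mem_of_lt h).2⟩

theorem height_union_le (h : ∀ n, (C n).height ≤ β) : (union C hC).height ≤ β := by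
  rw [height_le_iff]
  intro x hx
  obtain ⟨n, hn⟩ := Set.mem_iUnion.1 hx
  rw [level_union hC hn]
  exact (level_lt_height _ hn).trans_le (h n)

theorem EndExt.height_le (h : EndExt T T') : T.height ≤ T'.height := by
  rw [height_le_iff]
  intro x hx
  rw [← h.level_eq hx]
  exact level_lt_height _ (h.mem hx)

theorem isBalanced_union (hb : ∀ n, (C n).IsBalanced) : (union C hC).IsBalanced := by
  intro x hx γ hγ
  obtain ⟨m, hm⟩ := Set.mem_iUnion.1 hx
  obtain ⟨w, hw, rfl⟩ := exists_mem_level_eq hγ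
  obtain ⟨n, hn⟩ := Set.mem_iUnion.1 hw
  have hxk := (hC m _ (le_max_left m n)).mem hm
  have hwk := (hC n _ (le_max_right m n)).mem hn
  have hγ' := level_lt_height _ hwk
  rw [← level_union hC hwk] at hγ'
  obtain ⟨y, hy, e, h⟩ := hb _ x hxk _ hγ'
  refine ⟨y, Set.mem_iUnion.2 ⟨_, hy⟩, by rw [level_union hC hy, e], ?_⟩
  rcases h with h | h | h
  · exact Or.inl ⟨_, h⟩
  · exact Or.inr (Or.inl h)
  · exact Or.inr (Or.inr ⟨_, h⟩)

end Union

/-! ### Adding a top level -/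

/-- A cofinal branch of `T`: a downward closed chain that meets all levels. -/
structure IsCofinalBranch (T : CTree.{u}) (b : Set Omega1.{u}) : Prop where
  subset : b ⊆ T.carrier
  chain : ∀ x ∈ b, ∀ y ∈ b, T.le x y ∨ T.le y x
  down : ∀ y ∈ b, ∀ x, T.lt x y → x ∈ b
  cofinal : ∀ γ < T.height, ∃ x ∈ b, T.level x = γ

/-- The tree obtained from `T` by adding a node `e i` above the branch `b i`, for each `i`. -/
def extend (T : CTree.{u}) (b : ℕ → Set Omega1.{u}) (hb : ∀ i, T.IsCofinalBranch (b i))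
    (e : ℕ → Omega1.{u}) (he : e.Injective) (heT : ∀ i, e i ∉ T.carrier) : CTree.{u} where
  carrier := T.carrier ∪ Set.range e
  countable := T.countable.union (Set.countable_range e)
  lt x y := T.lt x y ∨ ∃ i, y = e i ∧ x ∈ b i
  mem_of_lt := by
    rintro x y (h | ⟨i, rfl, h⟩)
    · exact ⟨Or.inl (T.mem_of_lt h).1, Or.inl (T.mem_of_lt h).2⟩
    · exact ⟨Or.inl ((hb i).subset h), Or.inr ⟨i, rfl⟩⟩
  lt_trans := by
    rintro x y z (h | ⟨i, rfl, h⟩) (h' | ⟨j, rfl, h'⟩)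
    · exact Or.inl (T.lt_trans h h')
    · exact Or.inr ⟨j, rfl, (hb j).down y h' x h⟩
    · exact (heT i (T.mem_of_lt h').1).elim
    · exact (heT i ((hb j).subset h')).elim
  wf := by
    have key : ∀ x ∈ T.carrier, Acc (fun x y => T.lt x y ∨ ∃ i, y = e i ∧ x ∈ b i) x := by
      intro x
      induction x using T.wf.induction with
      | _ x ih =>
        refine fun hx => ⟨x, fun y hy => ?_⟩
        rcases hy with hy | ⟨i, rfl, -⟩
        · exact ih y hy (T.mem_of_lt hy).1
        · exact (heT i hx).elim
    refine ⟨fun x => ⟨x, fun y hy => key y ?_⟩⟩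
    rcases hy with hy | ⟨i, rfl, h⟩
    · exact (T.mem_of_lt hy).1
    · exact (hb i).subset h
  linear := by
    rintro x y z (h | ⟨i, rfl, h⟩) (h' | ⟨j, hj, h'⟩)
    · rcases T.linear h h' with h | h | h
      · exact Or.inl h
      · exact Or.inr (Or.inl (Or.inl h))
      · exact Or.inr (Or.inr (Or.inl h))
    · exact (heT j (hj ▸ (T.mem_of_lt h).2)).elim
    · exact (heT i (T.mem_of_lt h').2).elim
    · obtain rfl := he hj
      rcases (hb i).chain x h y h' with (h | h) | (h | h)
      · exact Or.inl h
      · exact Or.inr (Or.inl (Or.inl h))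
      · exact Or.inl h.symm
      · exact Or.inr (Or.inr (Or.inl h))

theorem exists_injective_notMem (T : CTree.{u}) :
    ∃ e : ℕ → Omega1.{u}, e.Injective ∧ ∀ i, e i ∉ T.carrier := by
  have h : (T.carrierᶜ).Infinite := by
    intro hfin
    have : (Set.univ : Set Omega1.{u}).Countable := by
      rw [← Set.union_compl_self T.carrier]
      exact T.countable.union hfin.countable
    rw [Set.countable_univ_iff, ← Cardinal.mk_le_aleph0_iff] at this
    simp at this
  exact ⟨fun i => h.natEmbedding _ i, fun i j hij => (h.natEmbedding _).injective
    (Subtype.ext hij), fun i => (h.natEmbedding _ i).2⟩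

/-- A balanced tree that is covered by countably many cofinal branches has a balanced
end-extension whose additional top level consists of one node for each of the branches. -/
theorem exists_extend (hT : T.IsBalanced) {b : ℕ → Set Omega1.{u}}
    (hb : ∀ i, T.IsCofinalBranch (b i)) (hcov : ∀ x ∈ T.carrier, ∃ i, x ∈ b i) :
    ∃ (T' : CTree.{u}) (e : ℕ → Omega1.{u}), e.Injective ∧ T'.IsBalanced ∧
      T'.height = Order.succ T.height ∧ EndExt T T' ∧
      (∀ i, e i ∈ T'.carrier ∧ T'.level (e i) = T.height ∧ ∀ x, T'.lt x (e i) ↔ x ∈ b i) ∧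
      ∀ z ∈ T'.carrier, T'.level z = T.height → ∃ i, z = e i := by
  obtain ⟨e, he, heT⟩ := T.exists_injective_notMem
  set T' := T.extend b hb e he heT with hT'
  have hlt : ∀ x ∈ T.carrier, ∀ y, T'.lt y x ↔ T.lt y x := fun x hx y =>
    ⟨fun h => h.resolve_right fun ⟨i, hi, _⟩ => heT i (hi ▸ hx), Or.inl⟩
  have hlev := level_eq_of_initial hlt
  have hlte : ∀ i x, T'.lt x (e i) ↔ x ∈ b i := fun i x =>
    ⟨fun h => h.elim (fun h => (heT i (T.mem_of_lt h).2).elim)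
      fun ⟨j, hj, hx⟩ => he hj ▸ hx, fun h => Or.inr ⟨i, rfl, h⟩⟩
  have hleve : ∀ i, T'.level (e i) = T.height := by
    intro i
    apply le_antisymm
    · rw [level_eq_iSup]
      refine Ordinal.iSup_le fun ⟨y, hy⟩ => ?_
      have hyT := (hb i).subset ((hlte i y).1 hy)
      rw [Order.succ_le_iff, hlev y hyT]
      exact T.level_lt_height hyT
    · by_contra! h
      obtain ⟨x, hx, e'⟩ := (hb i).cofinal _ h
      have := T'.level_lt ((hlte i x).2 hx)
      rw [hlev x ((hb i).subset hx), e'] at this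
      exact this.false
  have hmem : ∀ i, e i ∈ T'.carrier := fun i => Or.inr ⟨i, rfl⟩
  have hh : T'.height = Order.succ T.height := by
    apply le_antisymm
    · rw [height_le_iff]
      rintro x (hx | ⟨i, rfl⟩)
      · rw [hlev x hx]
        exact (T.level_lt_height hx).trans (Order.lt_succ _)
      · rw [hleve i]
        exact Order.lt_succ _
    · rw [Order.succ_le_iff, ← hleve 0]
      exact T'.level_lt_height (hmem 0)
  refine ⟨T', e, he, ?_, hh, ?_, fun i => ⟨hmem i, hleve i, hlte i⟩, ?_⟩
  · rintro x hx γ hγ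
    rw [hh] at hγ
    rcases (Order.lt_succ_iff.1 hγ).eq_or_lt with rfl | hγ'
    · rcases hx with hx | ⟨i, rfl⟩
      · obtain ⟨i, hi⟩ := hcov x hx
        exact ⟨e i, hmem i, hleve i, Or.inr (Or.inr ((hlte i x).2 hi))⟩
      · exact ⟨e i, hmem i, hleve i, Or.inr (Or.inl rfl)⟩
    · rcases hx with hx | ⟨i, rfl⟩
      · obtain ⟨y, hy, hyl, h⟩ := hT x hx γ hγ'
        refine ⟨y, Or.inl hy, by rw [hlev y hy, hyl], ?_⟩
        rwa [hlt x hx, hlt y hy]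
      · obtain ⟨y, hy, hyl⟩ := (hb i).cofinal γ hγ'
        exact ⟨y, Or.inl ((hb i).subset hy), by rw [hlev y ((hb i).subset hy), hyl],
          Or.inl ((hlte i y).2 hy)⟩
  · have key : ∀ x ∈ T'.carrier, T'.level x < T.height → x ∈ T.carrier := by
      rintro x (hx | ⟨i, rfl⟩) h
      · exact hx
      · rw [hleve i] at h
        exact h.false.elim
    ext x y
    · exact ⟨fun h => key x h.1 h.2, fun h => ⟨Or.inl h, by
        rw [hlev x h]; exact T.level_lt_height h⟩⟩
    · constructor
      · rintro ⟨h, h'⟩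
        exact (hlt y (key y (T'.mem_of_lt h).2 h') x).1 h
      · intro h
        have hy := (T.mem_of_lt h).2
        exact ⟨Or.inl h, by rw [hlev y hy]; exact T.level_lt_height hy⟩
  · rintro z (hz | ⟨i, rfl⟩) h
    · rw [hlev z hz] at h
      exact ((T.level_lt_height hz).ne h).elim
    · exact ⟨i, rfl⟩

/-- The downward closure of an increasing sequence of nodes of unbounded level is a cofinal
branch. -/
theorem isCofinalBranch_of_seq {s : ℕ → Omega1.{u}} (hs : ∀ n, s n ∈ T.carrier)
    (hmono : ∀ n, T.le (s n) (s (n + 1))) (hcof : ∀ γ < T.height, ∃ n, γ ≤ T.level (s n)) :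
    T.IsCofinalBranch {x | ∃ n, T.le x (s n)} := by
  have hm : ∀ m n, m ≤ n → T.le (s m) (s n) := fun m n h =>
    Nat.le_induction (T.le_refl _) (fun k _ h => le_trans h (hmono k)) n h
  refine ⟨fun x ⟨n, hn⟩ => mem_of_le hn (hs n), ?_, ?_, ?_⟩
  · rintro x ⟨m, hx⟩ y ⟨n, hy⟩
    exact linear_le (le_trans hx (hm m _ (le_max_left m n)))
      (le_trans hy (hm n _ (le_max_right m n)))
  · rintro y ⟨n, hy⟩ x hx
    exact ⟨n, le_trans (Or.inr hx) hy⟩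
  · intro γ hγ
    obtain ⟨n, hn⟩ := hcof γ hγ
    obtain ⟨x, hx, e⟩ := exists_le_level_eq hn
    exact ⟨x, ⟨n, hx⟩, e⟩

theorem IsBalanced.exists_branch (hT : T.IsBalanced) (hx : x ∈ T.carrier) :
    ∃ b, T.IsCofinalBranch b ∧ x ∈ b := by
  have hne : (Set.Iio T.height).Nonempty := ⟨_, T.level_lt_height hx⟩
  obtain ⟨δ, hδ⟩ := T.countable_Iio_height.exists_eq_range hne
  have hδ' : ∀ n, δ n < T.height := fun n => by
    have : δ n ∈ Set.range δ := ⟨n, rfl⟩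
    rwa [← hδ] at this
  have : Nonempty Omega1.{u} := ⟨x⟩
  choose! F hF using fun (γ : Ordinal.{u}) (y : Omega1.{u}) (h : γ < T.height ∧ y ∈ T.carrier) =>
    hT.exists_le h.2 h.1
  let s : ℕ → Omega1.{u} := fun n => Nat.rec x (fun n y => F (δ n) y) n
  have hs : ∀ n, s n ∈ T.carrier := fun n => by
    induction n with
    | zero => exact hx
    | succ n ih => exact (hF (δ n) (s n) ⟨hδ' n, ih⟩).1
  refine ⟨_, isCofinalBranch_of_seq hs (fun n => (hF (δ n) (s n) ⟨hδ' n, hs n⟩).2.1) ?_,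
    0, T.le_refl x⟩
  intro γ hγ
  have : γ ∈ Set.range δ := hδ ▸ hγ
  obtain ⟨n, rfl⟩ := this
  exact ⟨n + 1, (hF (δ n) (s n) ⟨hδ' n, hs n⟩).2.2⟩

theorem isCofinalBranch_empty (h : T.carrier = ∅) : T.IsCofinalBranch ∅ := by
  refine ⟨by simp, by simp, by simp, fun γ hγ => ?_⟩
  obtain ⟨x, hx, -⟩ := exists_mem_level_eq hγ
  simp [h] at hx

/-- A balanced tree has a balanced end-extension by one level in which every node of the new level
lies above a node of a given cofinal set `M`, and every old node lies below two new ones. -/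
theorem IsBalanced.exists_extend_through (hT : T.IsBalanced) {M : Set Omega1.{u}}
    (hM : ∀ x ∈ T.carrier, ∃ y ∈ M, T.le x y) :
    ∃ T' : CTree.{u}, T'.IsBalanced ∧ T'.height = Order.succ T.height ∧ EndExt T T' ∧
      (T.carrier.Nonempty →
        ∀ z ∈ T'.carrier, T'.level z = T.height → ∃ y ∈ M, T'.lt y z) ∧
      ∀ x ∈ T.carrier, ∃ z z', z ≠ z' ∧ T'.level z = T.height ∧ T'.level z' = T.height ∧
        T'.lt x z ∧ T'.lt x z' := by
  rcases T.carrier.eq_empty_or_nonempty with h0 | hne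
  · obtain ⟨T', e, -, h1, h2, h3, -⟩ := exists_extend hT (b := fun _ => ∅)
      (fun _ => isCofinalBranch_empty h0) (by simp [h0])
    exact ⟨T', h1, h2, h3, fun h => by simp [h0] at h, by simp [h0]⟩
  · have hbr : ∀ x : T.carrier, ∃ b, T.IsCofinalBranch b ∧ x.1 ∈ b ∧ ∃ y ∈ M, y ∈ b := by
      intro x
      obtain ⟨y, hy, hxy⟩ := hM x x.2
      obtain ⟨b, hb, hyb⟩ := hT.exists_branch (mem_of_le' hxy x.2)
      refine ⟨b, hb, ?_, y, hy, hyb⟩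
      rcases hxy with h | h
      · exact h ▸ hyb
      · exact hb.down y hyb _ h
    choose b hb hxb hMb using hbr
    have := T.countable.to_subtype
    have := hne.to_subtype
    obtain ⟨s, hs⟩ := exists_surjective_nat T.carrier
    -- each branch is used infinitely often, so that every node splits
    obtain ⟨T', e, he, h1, h2, h3, h4, h5⟩ := exists_extend hT
      (b := fun n => b (s n.unpair.1)) (fun _ => hb _) (fun x hx => by
        obtain ⟨n, hn⟩ := hs ⟨x, hx⟩
        refine ⟨Nat.pair n 0, ?_⟩
        have := hxb ⟨x, hx⟩
        simpa [hn] using this)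
    refine ⟨T', h1, h2, h3, fun _ z hz hzl => ?_, fun x hx => ?_⟩
    · obtain ⟨i, rfl⟩ := h5 z hz hzl
      obtain ⟨y, hy, hyb⟩ := hMb (s i.unpair.1)
      exact ⟨y, hy, ((h4 i).2.2 y).2 hyb⟩
    · obtain ⟨n, hn⟩ := hs ⟨x, hx⟩
      have hx' := hxb ⟨x, hx⟩
      refine ⟨e (Nat.pair n 0), e (Nat.pair n 1), fun h => ?_, (h4 _).2.1, (h4 _).2.1,
        ((h4 _).2.2 x).2 ?_, ((h4 _).2.2 x).2 ?_⟩
      · have := he h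
        rw [Nat.pair_eq_pair] at this
        simp at this
      · simpa [hn] using hx'
      · simpa [hn] using hx'

/-- A balanced tree has a balanced end-extension by one level in which a given cofinal branch is
extended. -/
theorem IsBalanced.exists_extend_branch (hT : T.IsBalanced) {c : Set Omega1.{u}}
    (hc : T.IsCofinalBranch c) :
    ∃ T' : CTree.{u}, T'.IsBalanced ∧ T'.height = Order.succ T.height ∧ EndExt T T' ∧
      ∃ z ∈ T'.carrier, T'.level z = T.height ∧ ∀ x ∈ c, T'.lt x z := by
  have hbr : ∀ x : Omega1.{u}, ∃ b, T.IsCofinalBranch b ∧ (x ∈ T.carrier → x ∈ b) := by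
    intro x
    by_cases hx : x ∈ T.carrier
    · obtain ⟨b, hb, hxb⟩ := hT.exists_branch hx
      exact ⟨b, hb, fun _ => hxb⟩
    · exact ⟨c, hc, fun h => (hx h).elim⟩
  choose b hb hxb using hbr
  have hs : ∃ s : ℕ → Omega1.{u}, T.carrier ⊆ Set.range s := by
    rcases T.carrier.eq_empty_or_nonempty with h0 | hne
    · obtain ⟨e, -⟩ := T.exists_injective_notMem
      exact ⟨e, by simp [h0]⟩
    · obtain ⟨s, hs⟩ := T.countable.exists_eq_range hne
      exact ⟨s, hs.subset⟩
  obtain ⟨s, hs⟩ := hs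
  obtain ⟨T', e, he, h1, h2, h3, h4, h5⟩ := exists_extend hT
    (b := fun n => Nat.casesOn n c fun n => b (s n))
    (fun n => by cases n with
      | zero => exact hc
      | succ n => exact hb _)
    (fun x hx => by
      obtain ⟨n, rfl⟩ := hs hx
      exact ⟨n + 1, hxb _ hx⟩)
  exact ⟨T', h1, h2, h3, e 0, (h4 0).1, (h4 0).2.1, fun x hx => ((h4 0).2.2 x).2 hx⟩

end CTree

theorem exists_isCoding : ∃ f : CTree.{u} → CTree.{u}, IsCoding f := by
  have h : ∀ T : CTree.{u}, ∃ T' : CTree.{u}, T.IsBalanced → T'.IsBalanced ∧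
      T'.height = Order.succ T.height ∧ T'.restrict T.height = T := by
    intro T
    by_cases hT : T.IsBalanced
    · obtain ⟨T', h1, h2, h3, -⟩ := hT.exists_extend_through (M := T.carrier)
        fun x hx => ⟨x, hx, T.le_refl x⟩
      exact ⟨T', fun _ => ⟨h1, h2, h3⟩⟩
    · exact ⟨T, fun h => (hT h).elim⟩
  choose f hf using h
  exact ⟨f, hf⟩

/-! ### Stationary subsets of a regular uncountable cardinal -/

/-- The well-order `K` has the order type of a regular uncountable cardinal: every proper initial
segment is smaller than `K`, and every subset smaller than `K` is strictly bounded. -/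
structure IsRegularUncountable (K : Type u) [LinearOrder K] : Prop where
  exists_bound : ∀ s : Set K, #s < #K → ∃ a, ∀ x ∈ s, x < a
  mk_Iio_lt : ∀ a : K, #(Set.Iio a) < #K
  aleph0_lt : ℵ₀ < #K

namespace IsRegularUncountable

variable {K : Type u} [LinearOrder K] [WellFoundedLT K] (hK : IsRegularUncountable K)
include hK

omit [WellFoundedLT K] in
theorem exists_bound_of_countable {s : Set K} (hs : s.Countable) : ∃ a, ∀ x ∈ s, x < a :=
  hK.exists_bound s ((Cardinal.le_aleph0_iff_set_countable.2 hs).trans_lt hK.aleph0_lt)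

omit [WellFoundedLT K] in
theorem exists_gt (a : K) : ∃ b, a < b := by
  obtain ⟨b, hb⟩ := hK.exists_bound_of_countable (Set.countable_singleton a)
  exact ⟨b, hb a rfl⟩

theorem exists_isLUB_of_countable {s : Set K} (hs : s.Countable) : ∃ a, IsLUB s a := by
  obtain ⟨b, hb⟩ := hK.exists_bound_of_countable hs
  have hne : (upperBounds s).Nonempty := ⟨b, fun x hx => (hb x hx).le⟩
  exact ⟨wellFounded_lt.min _ hne, wellFounded_lt.min_mem _ hne,
    fun c hc => not_lt.1 (wellFounded_lt.not_lt_min _ hc)⟩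

/-- The points closed under a finitary operation form a club. -/
theorem isClub_closed (o : List K → K) :
    IsClub {γ : K | ∀ l : List K, (∀ i ∈ l, i < γ) → o l < γ} := by
  constructor
  · intro t ht hne _ a ha l hl
    have : ∃ x ∈ t, ∀ i ∈ l, i < x := by
      induction l with
      | nil => exact ⟨_, hne.some_mem, by simp⟩
      | cons j l ih =>
        obtain ⟨x, hx, hxl⟩ := ih fun i hi => hl i (List.mem_cons_of_mem _ hi)
        obtain ⟨y, hy, hjy⟩ := (lt_isLUB_iff ha).1 (hl j List.mem_cons_self)
        refine ⟨max x y, ?_, ?_⟩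
        · rcases max_choice x y with h | h <;> rw [h] <;> assumption
        · intro i hi
          rcases List.mem_cons.1 hi with rfl | hi
          · exact lt_max_of_lt_right hjy
          · exact lt_max_of_lt_left (hxl i hi)
    obtain ⟨x, hx, hxl⟩ := this
    exact (ht hx l hxl).trans_le (ha.1 hx)
  · intro a
    have hG : ∀ a : K, ∃ b, a < b ∧ ∀ l : List K, (∀ i ∈ l, i < a) → o l < b := by
      intro a
      obtain ⟨b, hb⟩ := hK.exists_bound
        (Set.range fun l : List (Set.Iio a) => o (l.map Subtype.val)) (by
          refine mk_range_le.trans_lt ((mk_list_le_max _).trans_lt ?_)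
          exact max_lt hK.aleph0_lt (hK.mk_Iio_lt a))
      obtain ⟨c, hc⟩ := hK.exists_gt (max a b)
      refine ⟨c, (le_max_left a b).trans_lt hc, fun l hl => ?_⟩
      refine (hb _ ⟨l.attachWith (· ∈ Set.Iio a) hl, ?_⟩).trans ((le_max_right a b).trans_lt hc)
      exact congrArg o (List.attachWith_map_subtype_val hl)
    choose G hG1 hG2 using hG
    let s : ℕ → K := fun n => G^[n] a
    have hs : ∀ n, s (n + 1) = G (s n) := fun n => Function.iterate_succ_apply' G n a
    obtain ⟨γ, hγ⟩ := hK.exists_isLUB_of_countable (Set.countable_range s)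
    have hmono : StrictMono s := strictMono_nat_of_lt_succ fun n => hs n ▸ hG1 _
    refine ⟨γ, fun l hl => ?_, hγ.1 ⟨0, rfl⟩⟩
    have : ∃ n, ∀ i ∈ l, i < s n := by
      induction l with
      | nil => exact ⟨0, by simp⟩
      | cons j l ih =>
        obtain ⟨m, hm⟩ := ih fun i hi => hl i (List.mem_cons_of_mem _ hi)
        obtain ⟨_, ⟨n, rfl⟩, hn⟩ := (lt_isLUB_iff hγ).1 (hl j List.mem_cons_self)
        refine ⟨max m n, fun i hi => ?_⟩
        rcases List.mem_cons.1 hi with rfl | hi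
        · exact hn.trans_le (hmono.monotone (le_max_right m n))
        · exact (hm i hi).trans_le (hmono.monotone (le_max_left m n))
    obtain ⟨n, hn⟩ := this
    exact (hs n ▸ hG2 _ l hn).trans_le (hγ.1 ⟨n + 1, rfl⟩)

/-- Fodor's lemma: a regressive function on a stationary set is constant on a stationary set. -/
theorem fodor {s : Set K} (hs : IsStationary s) {h : K → K} (hh : ∀ x ∈ s, h x < x) :
    ∃ η, IsStationary {x ∈ s | h x = η} := by
  by_contra! hcon
  simp only [not_isStationary_iff] at hcon
  choose C hC hd using hcon
  have hnext : ∀ η ξ, ∃ c ∈ C η, ξ < c := fun η ξ => by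
    obtain ⟨ξ', hξ'⟩ := hK.exists_gt ξ
    obtain ⟨c, hc, h⟩ := (hC η).isCofinal ξ'
    exact ⟨c, hc, hξ'.trans_le h⟩
  choose next hn1 hn2 using hnext
  let o : List K → K := fun l => match l with
    | [η, ξ] => next η ξ
    | _ => (hs.nonempty.some)
  obtain ⟨x, hxs, hx⟩ := hs (hK.isClub_closed o)
  have hclosed : ∀ η < x, ∀ ξ < x, next η ξ < x := fun η hη ξ hξ =>
    hx [η, ξ] (by simp [hη, hξ])
  have hxC : x ∈ C (h x) := by
    refine (hC (h x)).isLUB_mem (t := {c ∈ C (h x) | c < x}) (fun c hc => hc.1)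
      ⟨_, hn1 (h x) (h x), hclosed _ (hh x hxs) _ (hh x hxs)⟩ ⟨fun c hc => hc.2.le, fun b hb => ?_⟩
    by_contra! hbx
    exact (hb ⟨hn1 (h x) b, hclosed _ (hh x hxs) _ hbx⟩).not_gt (hn2 _ _)
  exact Set.disjoint_left.1 (hd (h x)) ⟨hxs, rfl⟩ hxC

omit hK [WellFoundedLT K] in
theorem exists_seq_of_cof_eq {γ : K} (h : Order.cof (Set.Iio γ) = ℵ₀) :
    ∃ s : ℕ → K, (∀ n, s n < γ) ∧ ∀ a < γ, ∃ n, a ≤ s n := by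
  obtain ⟨A, hA, hA'⟩ := Order.exists_cof_eq (Set.Iio γ)
  rw [h] at hA'
  have hne : A.Nonempty := by
    rw [Set.nonempty_iff_ne_empty]
    rintro rfl
    simp at hA'
    exact aleph0_ne_zero hA'.symm
  obtain ⟨s, rfl⟩ := (Cardinal.le_aleph0_iff_set_countable.1 hA'.le).exists_eq_range hne
  refine ⟨fun n => s n, fun n => (s n).2, fun a ha => ?_⟩
  obtain ⟨_, ⟨n, rfl⟩, hn⟩ := hA ⟨a, ha⟩
  exact ⟨n, hn⟩

omit hK [WellFoundedLT K] in
theorem cof_eq_of_seq {γ : K} {s : ℕ → K} (hs : StrictMono s) (hγ : IsLUB (Set.range s) γ) :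
    Order.cof (Set.Iio γ) = ℵ₀ := by
  have hlt : ∀ n, s n < γ := fun n => (hs n.lt_succ_self).trans_le (hγ.1 ⟨n + 1, rfl⟩)
  have := Order.lift_cof_congr_of_strictMono (f := fun n => (⟨s n, hlt n⟩ : Set.Iio γ))
    (fun m n h => hs h) (by
      rintro ⟨a, ha⟩
      obtain ⟨_, ⟨n, rfl⟩, hn⟩ := (lt_isLUB_iff hγ).1 ha
      exact ⟨_, ⟨n, rfl⟩, hn.le⟩)
  simpa using this.symm

theorem isStationary_cof_eq_aleph0 : IsStationary {γ : K | Order.cof (Set.Iio γ) = ℵ₀} := by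
  intro C hC
  have : Nonempty K := by
    rw [← mk_ne_zero_iff]
    exact (aleph0_pos.trans hK.aleph0_lt).ne'
  have hnext : ∀ ξ, ∃ c ∈ C, ξ < c := fun ξ => by
    obtain ⟨ξ', hξ'⟩ := hK.exists_gt ξ
    obtain ⟨c, hc, h⟩ := hC.isCofinal ξ'
    exact ⟨c, hc, hξ'.trans_le h⟩
  choose G hG1 hG2 using hnext
  let s : ℕ → K := fun n => G^[n + 1] (Classical.arbitrary K)
  have hs : ∀ n, s n = G (G^[n] (Classical.arbitrary K)) := fun n =>
    Function.iterate_succ_apply' G n _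
  obtain ⟨γ, hγ⟩ := hK.exists_isLUB_of_countable (Set.countable_range s)
  have hmono : StrictMono s := strictMono_nat_of_lt_succ fun n => by
    rw [hs (n + 1)]; exact hG2 _
  refine ⟨γ, cof_eq_of_seq hmono hγ, hC.isLUB_mem ?_ (Set.range_nonempty s) hγ⟩
  rintro _ ⟨n, rfl⟩
  rw [hs]
  exact hG1 _

theorem exists_gt_cof_ne (a : K) : ∃ b, a < b ∧ Order.cof (Set.Iio b) ≠ ℵ₀ := by
  have hne : {b | a < b}.Nonempty := hK.exists_gt a
  set b := wellFounded_lt.min _ hne with hb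
  have hab : a < b := wellFounded_lt.min_mem _ hne
  refine ⟨b, hab, ?_⟩
  have : Order.cof (Set.Iio b) = 1 := by
    refine Order.cof_eq_one_iff.2 ⟨⟨a, hab⟩, fun ⟨c, hc⟩ => ?_⟩
    by_contra! h
    exact wellFounded_lt.not_lt_min _ h hc
  rw [this]
  exact one_lt_aleph0.ne

/-- The set of points of countable cofinality splits into two stationary sets. Let `a x n` be the
`n`-th term of a cofinal sequence in `x`. For some `n`, every `ξ` is bounded by `a x n` for
stationarily many `x`, and Fodor's lemma then yields two different values that `a x n` takes
stationarily often. -/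
theorem exists_stationary_costationary :
    ∃ S ⊆ {γ : K | Order.cof (Set.Iio γ) = ℵ₀}, IsStationary S ∧
      IsStationary ({γ : K | Order.cof (Set.Iio γ) = ℵ₀} \ S) := by
  set E := {γ : K | Order.cof (Set.Iio γ) = ℵ₀} with hE
  have hEs : IsStationary E := hK.isStationary_cof_eq_aleph0
  have hseq : ∀ x : K, ∃ s : ℕ → K, x ∈ E → (∀ n, s n < x) ∧ ∀ b < x, ∃ n, b ≤ s n := fun x => by
    by_cases hx : x ∈ E
    · obtain ⟨s, hs⟩ := exists_seq_of_cof_eq hx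
      exact ⟨s, fun _ => hs⟩
    · exact ⟨fun _ => x, fun h => (hx h).elim⟩
  choose a ha using hseq
  have hn : ∃ n, ∀ ξ, IsStationary {x ∈ E | ξ ≤ a x n} := by
    by_contra! hcon
    choose ξ hξ using hcon
    obtain ⟨ζ, hζ⟩ := hK.exists_bound_of_countable (Set.countable_range ξ)
    have hcl : ¬ IsStationary (⋃ n, {x ∈ E | ξ n ≤ a x n}) := by
      rw [isStationary_iUnion_iff_of_countable]
      · push Not
        exact hξ
      · intro hcof
        obtain ⟨A, hA, hA'⟩ := Order.exists_cof_eq K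
        rw [hcof] at hA'
        obtain ⟨b, hb⟩ := hK.exists_bound_of_countable
          (Cardinal.le_aleph0_iff_set_countable.1 hA'.le)
        obtain ⟨c, hc, hbc⟩ := hA b
        exact (hb c hc).not_ge hbc
    refine hcl fun C hC => ?_
    have hC' : IsClub (C ∩ Set.Ioi ζ) := by
      refine ⟨fun t ht hne hd b hb => ⟨hC.dirSupClosed (fun x hx => (ht hx).1) hne hd hb, ?_⟩, ?_⟩
      · exact lt_of_lt_of_le (ht hne.some_mem).2 (hb.1 hne.some_mem)
      · intro b
        obtain ⟨b', hb'⟩ := hK.exists_gt (max b ζ)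
        obtain ⟨c, hc, h⟩ := hC.isCofinal b'
        exact ⟨c, ⟨hc, (le_max_right b ζ).trans_lt (hb'.trans_le h)⟩,
          (le_max_left b ζ).trans (hb'.le.trans h)⟩
    obtain ⟨x, hxE, hxC, hxζ⟩ := hEs hC'
    obtain ⟨n, hn⟩ := (ha x hxE).2 ζ hxζ
    exact ⟨x, Set.mem_iUnion.2 ⟨n, hxE, (hζ _ ⟨n, rfl⟩).le.trans hn⟩, hxC⟩
  obtain ⟨n, hn⟩ := hn
  obtain ⟨η, hη⟩ := hK.fodor hEs (h := fun x => a x n) fun x hx => (ha x hx).1 n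
  obtain ⟨ξ, hξ⟩ := hK.exists_gt η
  obtain ⟨η', hη'⟩ := hK.fodor (hn ξ) (h := fun x => a x n) fun x hx => (ha x hx.1).1 n
  refine ⟨_, fun x hx => hx.1, hη, hη'.mono ?_⟩
  rintro x ⟨⟨hxE, hx⟩, -⟩
  exact ⟨hxE, fun h => (hξ.trans_le hx).ne' h.2⟩

/-- A run of length `ω` in which the `n`-th step depends on an ordinal `s n` can be arranged in such
a way that the ordinals `o` attached to the states, together with the parameters `s n`, have their
supremum in a given stationary set of points of countable cofinality. -/
theorem exists_run {E : Set K} (hE : IsStationary E)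
    (hcof : ∀ γ ∈ E, Order.cof (Set.Iio γ) = ℵ₀) {X : Type*} (init : X) (o : X → K)
    {R : X → K → X → Prop} (hR : ∀ x ν, ∃ y, R x ν y) :
    ∃ γ ∈ E, ∃ (s : ℕ → K) (st : ℕ → X), st 0 = init ∧ (∀ n, R (st n) (s n) (st (n + 1))) ∧
      (∀ n, s n < γ) ∧ (∀ a < γ, ∃ n, a ≤ s n) ∧ ∀ n, o (st n) < γ := by
  choose step hstep using hR
  obtain ⟨γ, hγE, hγ⟩ := hE (hK.isClub_closed fun l => o (l.foldr (fun ν x => step x ν) init))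
  obtain ⟨s, hs1, hs2⟩ := exists_seq_of_cof_eq (hcof γ hγE)
  -- the parameters of the first `n` steps, the last one first
  let l : ℕ → List K := fun n => Nat.rec [] (fun n l => s n :: l) n
  have hl : ∀ n, ∀ i ∈ l n, i < γ := by
    intro n
    induction n with
    | zero => simp [l]
    | succ n ih =>
      intro i hi
      rcases List.mem_cons.1 hi with rfl | hi
      · exact hs1 n
      · exact ih i hi
  exact ⟨γ, hγE, s, fun n => (l n).foldr (fun ν x => step x ν) init, rfl, fun n => hstep _ _,
    hs1, hs2, fun n => hγ _ (hl n)⟩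

end IsRegularUncountable

/-! ### Measurable cardinals -/

section Measurable

variable {κ : Cardinal.{u}}

theorem mk_Iio_ord_toType_lt (a : κ.ord.ToType) : #(Set.Iio a) < κ := by
  have h := card_typein_lt (r := ((· < ·) : κ.ord.ToType → κ.ord.ToType → Prop)) a (by simp)
  simp only [card_typein, mk_ord_toType] at h
  exact h

theorem compl_mem_of_mk_lt {U : Ultrafilter κ.ord.ToType} (hU : ∀ x, ({x} : Set κ.ord.ToType) ∉ U)
    (hc : CardinalInterFilter (U : Filter κ.ord.ToType) κ) {s : Set κ.ord.ToType} (hs : #s < κ) :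
    sᶜ ∈ U := by
  have h : (⋂ i, ⋂ _ : i ∈ s, ({i} : Set κ.ord.ToType)ᶜ) ∈ (U : Filter κ.ord.ToType) :=
    (Filter.cardinal_bInter_mem hs).2 fun i _ => Ultrafilter.compl_mem_iff_notMem.2 (hU i)
  refine Filter.mem_of_superset h fun x hx hxs => ?_
  simp only [Set.mem_iInter] at hx
  exact hx x hxs rfl

theorem IsMeasurableCardinal.isRegularUncountable (hκ : IsMeasurableCardinal κ) :
    IsRegularUncountable κ.ord.ToType := by
  obtain ⟨h0, U, hU, hc⟩ := hκ
  refine ⟨fun s hs => ?_, fun a => by simpa using mk_Iio_ord_toType_lt a, by simpa using h0⟩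
  by_contra! hcon
  rw [mk_ord_toType] at hs
  have h : (⋂ i, ⋂ _ : i ∈ s, (Set.Iic i : Set κ.ord.ToType)ᶜ) ∈ (U : Filter κ.ord.ToType) := by
    refine (Filter.cardinal_bInter_mem hs).2 fun i _ => compl_mem_of_mk_lt hU hc ?_
    have : (Set.Iic i) = insert i (Set.Iio i) := by
      ext x; simp [le_iff_eq_or_lt]
    rw [this]
    exact mk_insert_le.trans_lt (add_lt_of_lt h0.le (mk_Iio_ord_toType_lt i)
      (one_lt_aleph0.trans h0))
  have h' := U.neBot.nonempty_of_mem h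
  obtain ⟨x, hx⟩ := h'
  obtain ⟨y, hy, hxy⟩ := hcon x
  simp only [Set.mem_iInter] at hx
  exact hx y hy hxy

/-- A measurable cardinal is a strong limit: if `κ` injects into the subsets of a set of size
`c < κ`, then the ultrafilter decides each of the `c` memberships, and by completeness it decides
them simultaneously, which makes it principal. -/
theorem IsMeasurableCardinal.isStrongPrelimit (hκ : IsMeasurableCardinal κ) :
    IsStrongPrelimit κ := by
  obtain ⟨h0, U, hU, hc⟩ := hκ
  intro c hcκ
  by_contra! hle
  rw [← mk_out c, ← mk_set, ← mk_ord_toType κ, Cardinal.le_def] at hle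
  obtain ⟨f⟩ := hle
  let A : Set c.out := {i | {x | i ∈ f x} ∈ U}
  have h : (⋂ i, {x | i ∈ f x ↔ i ∈ A}) ∈ (U : Filter κ.ord.ToType) := by
    refine (Filter.cardinal_iInter_mem (by rwa [mk_out])).2 fun i => ?_
    by_cases hi : i ∈ A
    · simp only [hi, iff_true]
      exact hi
    · have : {x | i ∈ f x}ᶜ ∈ U := Ultrafilter.compl_mem_iff_notMem.2 hi
      simp only [hi, iff_false]
      exact this
  obtain ⟨x, hx⟩ := U.neBot.nonempty_of_mem h
  refine hU x (Filter.mem_of_superset h fun y hy => f.injective ?_)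
  ext i
  simp only [Set.mem_iInter, Set.mem_ofPred_eq] at hx hy
  rw [hx i, hy i]

/-- A measurable cardinal carries a countably complete ultrafilter all of whose members are
unbounded. -/
theorem IsMeasurableCardinal.exists_ultrafilter (hκ : IsMeasurableCardinal κ) :
    ∃ U : Ultrafilter κ.ord.ToType, CountableInterFilter (U : Filter κ.ord.ToType) ∧
      ∀ A ∈ U, ∀ a, ∃ b ∈ A, a ≤ b := by
  obtain ⟨h0, U, hU, hc⟩ := hκ
  refine ⟨U, CardinalInterFilter.toCountableInterFilter _ h0, fun A hA a => ?_⟩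
  have h := compl_mem_of_mk_lt hU hc (mk_Iio_ord_toType_lt a)
  obtain ⟨b, hb, hb'⟩ := U.neBot.nonempty_of_mem (Filter.inter_mem hA h)
  exact ⟨b, hb, not_lt.1 hb'⟩

theorem IsMeasurableCardinal.exists_isStatCostat (hκ : IsMeasurableCardinal κ) :
    ∃ S : Set κ.ord.ToType, IsStatCostat S := by
  obtain ⟨S, h1, h2, h3⟩ := hκ.isRegularUncountable.exists_stationary_costationary
  exact ⟨S, h1, h2, h3⟩

end Measurable

/-! ### The forcing `Q₀` -/

namespace QZero

variable {κ : Cardinal.{u}} {S : Set κ.ord.ToType} {f : CTree.{u} → CTree.{u}}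
  {p q r : QZero S f} {x y : Omega1.{u}}

theorem length_le (h : p ≤ q) : q.length ≤ p.length := h.1

theorem g_eq (h : p ≤ q) {β : Ordinal.{u}} (hp : β < p.length) (hq : β < q.length) :
    p.g ⟨β, hp⟩ = q.g ⟨β, hq⟩ := h.2.1 ⟨β, hq⟩

theorem restrict_eq (h : p ≤ q) : p.tree.restrict q.length = q.tree := h.2.2

theorem endExt (h : p ≤ q) : CTree.EndExt q.tree p.tree := by
  rw [CTree.EndExt, q.height_eq]
  exact restrict_eq h

theorem mem_of_le (h : p ≤ q) (hx : x ∈ q.tree.carrier) : x ∈ p.tree.carrier := (endExt h).mem hx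

/-- Incomparable nodes have no common upper bound in any stronger condition. -/
theorem not_le_of_incomparable (h : p ≤ q) {z z' w : Omega1.{u}} (hz : z ∈ q.tree.carrier)
    (hz' : z' ∈ q.tree.carrier) (hn : ¬ q.tree.le z z') (hn' : ¬ q.tree.le z' z)
    (hw : p.tree.le z w) : ¬ p.tree.le z' w := by
  intro hw'
  rcases CTree.linear_le hw hw' with h' | h'
  · exact hn (((endExt h).le_iff hz').1 h')
  · exact hn' (((endExt h).le_iff hz).1 h')

theorem level_lt_length (hx : x ∈ q.tree.carrier) : q.tree.level x < q.length :=
  q.height_eq ▸ q.tree.level_lt_height hx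

/-- Two compatible conditions are comparable. -/
theorem le_of_le_of_le (hp : r ≤ p) (hq : r ≤ q) (h : q.length ≤ p.length) : p ≤ q := by
  refine ⟨h, fun β => ?_, ?_⟩
  · rw [← g_eq hq (β.2.trans_le (length_le hq)) β.2,
      ← g_eq hp (β.2.trans_le (length_le hq)) (lt_of_lt_of_le β.2 h)]
  · rw [← restrict_eq hp, CTree.restrict_restrict _ h, restrict_eq hq]

/-- A descending sequence of conditions has a greatest lower bound, the union of the sequence. -/
theorem exists_limit {p : ℕ → QZero S f} (hp : Antitone p) :
    ∃ q : QZero S f, (∀ n, q ≤ p n) ∧ (∀ r, (∀ n, r ≤ p n) → r ≤ q) ∧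
      ∀ β < q.length, ∃ n, β < (p n).length := by
  set L : Ordinal.{u} := ⨆ n, (p n).length with hL
  have hle : ∀ n, (p n).length ≤ L := fun n => Ordinal.le_iSup (fun n => (p n).length) n
  have hN : ∀ β : Set.Iio L, ∃ n, β.1 < (p n).length := fun β => by
    exact Ordinal.lt_iSup_iff.1 (show β.1 < ⨆ n, (p n).length from β.2)
  choose N hN' using hN
  have hagree : ∀ {m n β} (hm : β < (p m).length) (hn : β < (p n).length),
      (p m).g ⟨β, hm⟩ = (p n).g ⟨β, hn⟩ := by
    intro m n β hm hn
    rcases le_total m n with h | h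
    · exact (g_eq (hp h) hn hm).symm
    · exact g_eq (hp h) hm hn
  let G : Set.Iio L → κ.ord.ToType := fun β => (p (N β)).g ⟨β, hN' β⟩
  have hG : ∀ n β (h : β < (p n).length), G ⟨β, h.trans_le (hle n)⟩ = (p n).g ⟨β, h⟩ :=
    fun n β h => hagree _ _
  have hC : ∀ m n, m ≤ n → CTree.EndExt (p m).tree (p n).tree := fun m n h => endExt (hp h)
  set U := CTree.union (fun n => (p n).tree) hC with hU
  have hUr : ∀ n, U.restrict (p n).length = (p n).tree := fun n => by
    have := CTree.endExt_union hC n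
    rwa [CTree.EndExt, (p n).height_eq] at this
  have hUh : U.height = L := by
    apply le_antisymm
    · exact CTree.height_union_le hC fun n => (p n).height_eq.trans_le (hle n)
    · refine Ordinal.iSup_le fun n => ?_
      rw [← (p n).height_eq]
      exact (CTree.endExt_union hC n).height_le
  refine ⟨⟨L, ?_, G, ?_, ?_, U, ?_, hUh, ?_⟩, fun n => ⟨hle n, fun β => hG n β β.2, hUr n⟩, ?_,
    fun β hβ => ⟨_, hN' ⟨β, hβ⟩⟩⟩
  · exact Ordinal.iSup_lt_omega_one fun n => (p n).length_lt
  · rintro β ⟨β', h'⟩ h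
    have h2 := hN' ⟨β', h'⟩
    have h1 : β.1 < _ := lt_trans h h2
    rw [hG _ _ h2, show G β = _ from hG _ _ h1]
    exact (p _).g_strictMono h
  · rintro ⟨β, hβ⟩ hlim
    have h1 := hN' ⟨β, hβ⟩
    rw [hG _ _ h1]
    convert (p _).g_continuous ⟨β, h1⟩ hlim using 1
    ext a
    constructor
    · rintro ⟨⟨γ, hγ⟩, hγβ, rfl⟩
      have h2 : γ < _ := lt_trans hγβ h1
      exact ⟨⟨γ, h2⟩, hγβ, (hG _ _ h2).symm⟩
    · rintro ⟨⟨γ, hγ⟩, hγβ, rfl⟩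
      exact ⟨⟨γ, lt_trans (b := β) hγβ hβ⟩, hγβ, hG _ _ hγ⟩
  · exact CTree.isBalanced_union hC fun n => (p n).balanced
  · rintro ⟨β, hβ⟩ hS
    have h1 := hN' ⟨β, hβ⟩
    rw [hG _ _ h1] at hS
    have := (p _).coded ⟨β, h1⟩ hS
    rwa [← hUr, CTree.restrict_restrict _ (Order.succ_le_of_lt h1),
      CTree.restrict_restrict _ h1.le] at this
  · intro r hr
    refine ⟨Ordinal.iSup_le fun n => length_le (hr n), fun β => ?_, ?_⟩
    · exact g_eq (hr _) _ (hN' β)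
    · have key : ∀ x ∈ r.tree.carrier, r.tree.level x < L → ∃ n, x ∈ (p n).tree.carrier := by
        intro x hx hxl
        obtain ⟨n, hn⟩ := (Ordinal.lt_iSup_iff).1 hxl
        refine ⟨n, (endExt (hr n)).mem_iff.2 ⟨hx, by rwa [(p n).height_eq]⟩⟩
      have key' : ∀ n, ∀ x ∈ (p n).tree.carrier, r.tree.level x < L := fun n x hx => by
        rw [(endExt (hr n)).level_eq hx]
        exact (level_lt_length hx).trans_le (hle n)
      ext x y
      · constructor
        · rintro ⟨hx, hxl⟩
          obtain ⟨n, hn⟩ := key x hx hxl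
          exact Set.mem_iUnion.2 ⟨n, hn⟩
        · intro hx
          obtain ⟨n, hn⟩ := Set.mem_iUnion.1 hx
          exact ⟨mem_of_le (hr n) hn, key' n x hn⟩
      · constructor
        · rintro ⟨hxy, hyl⟩
          obtain ⟨n, hn⟩ := key y (r.tree.mem_of_lt hxy).2 hyl
          exact ⟨n, ((endExt (hr n)).lt_iff' hn).1 hxy⟩
        · rintro ⟨n, hn⟩
          have hy := ((p n).tree.mem_of_lt hn).2
          exact ⟨((endExt (hr n)).lt_iff' hy).2 hn, key' n y hy⟩

theorem isSigmaClosed : IsSigmaClosed (QZero S f) := fun _ hp =>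
  let ⟨q, hq, _⟩ := exists_limit hp
  ⟨q, hq⟩

/-- A condition can meet countably many open dense requirements at once. -/
theorem exists_forall_of_dense {ι : Type*} [Countable ι] {Φ : ι → QZero S f → Prop}
    (hmono : ∀ i q r, r ≤ q → Φ i q → Φ i r)
    (hdense : ∀ i, ∀ q ≤ p, ∃ r ≤ q, Φ i r) : ∃ q ≤ p, ∀ i, Φ i q := by
  cases isEmpty_or_nonempty ι
  · exact ⟨p, le_rfl, fun i => isEmptyElim i⟩
  obtain ⟨e, he⟩ := exists_surjective_nat ι
  have hstep : ∀ n, ∀ q : {q // q ≤ p}, ∃ r : {q // q ≤ p}, r ≤ q ∧ Φ (e n) r := fun n q => by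
    obtain ⟨r, hr, h⟩ := hdense (e n) q q.2
    exact ⟨⟨r, hr.trans q.2⟩, hr, h⟩
  choose F hF1 hF2 using hstep
  let t : ℕ → {q // q ≤ p} := fun n => Nat.rec ⟨p, le_rfl⟩ F n
  have ht : Antitone fun n => (t n).1 := antitone_nat_of_succ_le fun n => hF1 n (t n)
  obtain ⟨q, hq, -⟩ := exists_limit ht
  refine ⟨q, hq 0, fun i => ?_⟩
  obtain ⟨n, rfl⟩ := he i
  exact hmono _ _ _ (hq (n + 1)) (hF2 n (t n))

theorem countable_Iio_length (q : QZero S f) : (Set.Iio q.length).Countable := by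
  rw [← q.height_eq]
  exact q.tree.countable_Iio_height

section Extension

variable (hK : IsRegularUncountable κ.ord.ToType) (hf : IsCoding f)

include hK in
theorem exists_bound (q : QZero S f) : ∃ a, ∀ β, q.g β < a := by
  have := q.countable_Iio_length.to_subtype
  obtain ⟨a, ha⟩ := hK.exists_bound_of_countable (Set.countable_range q.g)
  exact ⟨a, fun β => ha _ ⟨β, rfl⟩⟩

/-- Extending a condition by one step: `ν` is the next value of `g` and `T'` the next tree. -/
theorem exists_succ (q : QZero S f) {ν : κ.ord.ToType} (hν : ∀ β, q.g β < ν)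
    (hlim : Order.IsSuccLimit q.length → IsLUB (Set.range q.g) ν) {T' : CTree.{u}}
    (hb : T'.IsBalanced) (hh : T'.height = Order.succ q.length) (hext : CTree.EndExt q.tree T')
    (hS : ν ∈ S → T' = f q.tree) :
    ∃ q' ≤ q, q'.length = Order.succ q.length ∧ q'.tree = T' ∧ ∃ β, q'.g β = ν := by
  let G : Set.Iio (Order.succ q.length) → κ.ord.ToType :=
    fun β => if h : β.1 < q.length then q.g ⟨β, h⟩ else ν
  have hG1 : ∀ β (h : β < q.length), G ⟨β, h.trans (Order.lt_succ _)⟩ = q.g ⟨β, h⟩ :=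
    fun β h => dif_pos h
  have hG2 : G ⟨q.length, Order.lt_succ q.length⟩ = ν := dif_neg (lt_irrefl _)
  rw [CTree.EndExt, q.height_eq] at hext
  have hcase : ∀ β : Set.Iio (Order.succ q.length),
      β.1 < q.length ∨ β = ⟨q.length, Order.lt_succ q.length⟩ :=
    fun β => (Order.lt_succ_iff.1 β.2).lt_or_eq.imp_right fun h => Subtype.ext h
  have himage : ∀ β (hβ : β ≤ q.length), G '' Set.Iio ⟨β, Order.lt_succ_of_le hβ⟩ =
      q.g '' {γ | γ.1 < β} := by
    intro β hβ
    ext a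
    constructor
    · rintro ⟨⟨γ, hγ⟩, hγβ, rfl⟩
      have h2 : γ < q.length := lt_of_lt_of_le hγβ hβ
      exact ⟨⟨γ, h2⟩, hγβ, (hG1 _ h2).symm⟩
    · rintro ⟨⟨γ, hγ⟩, hγβ, rfl⟩
      exact ⟨⟨γ, lt_trans (b := q.length) hγ (Order.lt_succ _)⟩, hγβ, hG1 _ hγ⟩
  refine ⟨⟨Order.succ q.length, ?_, G, ?_, ?_, T', hb, hh, ?_⟩,
    ⟨(Order.lt_succ _).le, fun β => hG1 β β.2, hext⟩, rfl, rfl, _, hG2⟩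
  · exact (isSuccLimit_omega 1).succ_lt q.length_lt
  · intro β β' h
    rcases hcase β' with h' | rfl
    · rw [show G β = _ from hG1 _ (lt_trans h h'), show G β' = _ from hG1 _ h']
      exact q.g_strictMono h
    · rw [hG2, show G β = _ from hG1 _ h]
      exact hν _
  · intro β hβ
    rcases hcase β with h | rfl
    · rw [show G β = _ from hG1 _ h,
        show Set.Iio β = Set.Iio ⟨β.1, Order.lt_succ_of_le h.le⟩ from rfl,
        himage β h.le]
      exact q.g_continuous ⟨β, h⟩ hβ
    · rw [hG2, himage _ le_rfl]
      convert hlim hβ using 1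
      ext a
      constructor
      · rintro ⟨γ, -, rfl⟩
        exact ⟨γ, rfl⟩
      · rintro ⟨γ, rfl⟩
        exact ⟨γ, γ.2, rfl⟩
  · intro β hβ
    rcases hcase β with h | rfl
    · rw [show G β = _ from hG1 _ h] at hβ
      have := q.coded ⟨β, h⟩ hβ
      rwa [← hext, CTree.restrict_restrict _ (Order.succ_le_of_lt h),
        CTree.restrict_restrict _ h.le] at this
    · rw [hG2] at hβ
      change T'.restrict (Order.succ q.length) = f (T'.restrict q.length)
      rw [← hh, CTree.restrict_height, hext, hS hβ]

include hf in
/-- Taking the level that `f` prescribes is allowed no matter whether the new value is in `S`. -/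
theorem exists_succ_coded (q : QZero S f) {ν : κ.ord.ToType} (hν : ∀ β, q.g β < ν)
    (hlim : Order.IsSuccLimit q.length → IsLUB (Set.range q.g) ν) :
    ∃ q' ≤ q, q'.length = Order.succ q.length ∧ ∃ β, q'.g β = ν := by
  obtain ⟨h1, h2, h3⟩ := hf q.tree q.balanced
  rw [q.height_eq] at h2
  obtain ⟨q', h, h', -, h''⟩ := exists_succ q hν hlim h1 h2 h3 fun _ => rfl
  exact ⟨q', h, h', h''⟩

include hK hf in
theorem exists_le_length_succ (q : QZero S f) :
    ∃ q' ≤ q, q'.length = Order.succ q.length := by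
  have hν : ∃ ν, (∀ β, q.g β < ν) ∧ (Order.IsSuccLimit q.length → IsLUB (Set.range q.g) ν) := by
    by_cases hl : Order.IsSuccLimit q.length
    · have := q.countable_Iio_length.to_subtype
      obtain ⟨ν, hν⟩ := hK.exists_isLUB_of_countable (Set.countable_range q.g)
      refine ⟨ν, fun β => ?_, fun _ => hν⟩
      have h' := hl.succ_lt β.2
      exact (q.g_strictMono (b := ⟨_, h'⟩) (Order.lt_succ β.1)).trans_le (hν.1 ⟨_, rfl⟩)
    · obtain ⟨ν, hν⟩ := q.exists_bound hK
      exact ⟨ν, hν, fun h => (hl h).elim⟩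
  obtain ⟨ν, hν, hl⟩ := hν
  obtain ⟨q', h, h', -⟩ := exists_succ_coded hf q hν hl
  exact ⟨q', h, h'⟩

include hK hf in
theorem exists_le_lt_length (q : QZero S f) {α : Ordinal.{u}} (hα : α < ω₁) :
    ∃ q' ≤ q, α < q'.length := by
  induction α using WellFoundedLT.induction generalizing q with
  | _ α ih =>
    have hc : Countable (Set.Iio α) := by
      rw [← Cardinal.mk_le_aleph0_iff, Cardinal.mk_Iio_ordinal, lift_le_aleph0, ← Order.lt_succ_iff,
        succ_aleph0]
      rwa [← lt_ord, ord_aleph]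
    obtain ⟨r, hr, h⟩ := exists_forall_of_dense (p := q) (ι := Set.Iio α)
      (Φ := fun i r => i.1 < r.length) (fun i q r h h' => h'.trans_le (length_le h))
      (fun i q' _ => ih i.1 i.2 q' (lt_trans i.2 hα))
    obtain ⟨q', hq', hl⟩ := r.exists_le_length_succ hK hf
    refine ⟨q', hq'.trans hr, ?_⟩
    rw [hl, Order.lt_succ_iff]
    exact le_of_forall_lt fun β hβ => h ⟨β, hβ⟩

include hK hf in
theorem exists_le_lt_g (q : QZero S f) (ν : κ.ord.ToType) : ∃ q' ≤ q, ∃ β, ν < q'.g β := by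
  obtain ⟨r, hr, hl⟩ := q.exists_le_length_succ hK hf
  obtain ⟨a, ha⟩ := r.exists_bound hK
  obtain ⟨b, hb⟩ := hK.exists_gt (max a ν)
  obtain ⟨q', h, -, β, hβ⟩ := exists_succ_coded hf r (ν := b)
    (fun β => (ha β).trans ((le_max_left _ _).trans_lt hb))
    (fun h => (Order.not_isSuccLimit_succ _ (hl ▸ h)).elim)
  exact ⟨q', h.trans hr, β, hβ ▸ (le_max_right _ _).trans_lt hb⟩

include hK hf in
/-- Every node can be made to split: choosing the next value of `g` of uncountable cofinality, and
hence outside of `S`, leaves the next level of the tree unrestricted. -/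
theorem exists_le_split (hS : S ⊆ {α | Order.cof (Set.Iio α) = ℵ₀}) (q : QZero S f) :
    ∃ q' ≤ q, ∀ x ∈ q.tree.carrier, ∃ z z', q'.tree.lt x z ∧ q'.tree.lt x z' ∧
      ¬ q'.tree.le z z' ∧ ¬ q'.tree.le z' z := by
  obtain ⟨r, hr, hl⟩ := q.exists_le_length_succ hK hf
  obtain ⟨a, ha⟩ := r.exists_bound hK
  obtain ⟨b, hb, hbS⟩ := hK.exists_gt_cof_ne a
  obtain ⟨T', h1, h2, h3, -, h4⟩ := r.balanced.exists_extend_through (M := r.tree.carrier)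
    fun x hx => ⟨x, hx, r.tree.le_refl x⟩
  rw [r.height_eq] at h2
  obtain ⟨q', h, -, rfl, -⟩ := exists_succ r (fun β => (ha β).trans hb)
    (fun h => (Order.not_isSuccLimit_succ _ (hl ▸ h)).elim) h1 h2 h3 (fun h => (hbS (hS h)).elim)
  refine ⟨q', h.trans hr, fun x hx => ?_⟩
  obtain ⟨z, z', hne, hz, hz', hxz, hxz'⟩ := h4 x (mem_of_le hr hx)
  refine ⟨z, z', hxz, hxz', ?_, ?_⟩
  · rintro (h | h)
    · exact hne h
    · exact (q'.tree.level_lt h).ne (hz.trans hz'.symm)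
  · rintro (h | h)
    · exact hne h.symm
    · exact (q'.tree.level_lt h).ne (hz'.trans hz.symm)

include hK hf in
/-- The node of a pair `(q, x)` can be extended to arbitrarily high countable levels. -/
theorem exists_le_level {q : QZero S f} {x : Omega1.{u}} (hx : x ∈ q.tree.carrier)
    {α : Ordinal.{u}} (hα : α < ω₁) :
    ∃ q' ≤ q, α < q'.length ∧ ∃ x' ∈ q'.tree.carrier, q'.tree.le x x' ∧
      α ≤ q'.tree.level x' := by
  obtain ⟨q', h, hl⟩ := q.exists_le_lt_length hK hf hα
  rw [← q'.height_eq] at hl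
  obtain ⟨y, hy, h1, h2⟩ := q'.balanced.exists_le (mem_of_le h hx) hl
  exact ⟨q', h, q'.height_eq ▸ hl, y, hy, h1, h2⟩

end Extension

/-- The limit of a descending sequence of conditions whose `g`-values are bounded by `γ` and cofinal
in `γ`. -/
theorem exists_limit_of_cofinal {p : ℕ → QZero S f} (hp : Antitone p) {γ : κ.ord.ToType}
    (hγ : ∃ a, a < γ) (hb : ∀ n β, (p n).g β < γ) (hcof : ∀ a < γ, ∃ n β, a < (p n).g β) :
    ∃ q : QZero S f, (∀ n, q ≤ p n) ∧ (∀ r, (∀ n, r ≤ p n) → r ≤ q) ∧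
      (∀ β < q.length, ∃ n, β < (p n).length) ∧ Order.IsSuccLimit q.length ∧
      (∀ β, q.g β < γ) ∧ IsLUB (Set.range q.g) γ := by
  obtain ⟨q, h1, h2, h3⟩ := exists_limit hp
  have hlt : ∀ β, q.g β < γ := by
    rintro ⟨β, hβ⟩
    obtain ⟨n, hn⟩ := h3 β hβ
    rw [g_eq (h1 n) hβ hn]
    exact hb _ _
  have hgt : ∀ a < γ, ∃ β, a < q.g β := by
    intro a ha
    obtain ⟨n, ⟨β, hβ⟩, h⟩ := hcof a ha
    exact ⟨⟨β, hβ.trans_le (length_le (h1 n))⟩, by rwa [g_eq (h1 n) _ hβ]⟩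
  refine ⟨q, h1, h2, h3, ?_, hlt, ?_⟩
  · rw [Order.isSuccLimit_iff_of_orderBot]
    obtain ⟨a, ha⟩ := hγ
    obtain ⟨β, -⟩ := hgt a ha
    refine ⟨(pos_of_gt β.2).ne', Order.isSuccPrelimit_of_succ_lt fun β hβ => ?_⟩
    obtain ⟨β', h⟩ := hgt _ (hlt ⟨β, hβ⟩)
    have h' : β < β'.1 := q.g_strictMono.lt_iff_lt.1 h
    exact (Order.succ_le_of_lt h').trans_lt β'.2
  · refine ⟨?_, fun b hb => ?_⟩
    · rintro _ ⟨β, rfl⟩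
      exact (hlt β).le
    · by_contra! h
      obtain ⟨β, hβ⟩ := hgt b h
      exact (hb ⟨β, rfl⟩).not_gt hβ

end QZero

/-! ### Sealing dense sets and the Souslin property -/

section Sealing

variable {κ : Cardinal.{u}} {S : Set κ.ord.ToType} {f : CTree.{u} → CTree.{u}}
  (hK : IsRegularUncountable κ.ord.ToType) (hf : IsCoding f) (hS : IsStatCostat S)

include hK hf hS in
/-- Sealing: every open dense set of pairs `(q, x)`, with `x` a node of the tree of `q`, contains
all pairs `(r, x)` with `x` on a suitable level of a suitable `r ≤ q`. The level is added at a stage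
at which the supremum of the values of `g` is outside of `S`, so that the branches to be extended
can be chosen freely. -/
theorem exists_sealed {Φ : QZero S f → Omega1.{u} → Prop}
    (hopen : ∀ q q' x x', Φ q x → q' ≤ q → q'.tree.le x x' → Φ q' x')
    (hdense : ∀ q, ∀ x ∈ q.tree.carrier, ∃ q' ≤ q, ∃ x', q'.tree.le x x' ∧ Φ q' x')
    (q : QZero S f) :
    ∃ r ≤ q, ∃ α < r.length, ∀ x ∈ r.tree.carrier, r.tree.level x = α → Φ r x := by
  have hR : ∀ (q : QZero S f) (ν : κ.ord.ToType), ∃ q', q' ≤ q ∧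
      (∀ x ∈ q.tree.carrier, ∃ x', q'.tree.le x x' ∧ Φ q' x') ∧ ∃ β, ν < q'.g β := by
    intro q ν
    have := q.tree.countable.to_subtype
    obtain ⟨r, hr, h⟩ := QZero.exists_forall_of_dense (p := q) (ι := q.tree.carrier)
      (Φ := fun x r => ∃ x', r.tree.le x x' ∧ Φ r x')
      (fun i q r hr ⟨x', hx', h⟩ => ⟨x', (QZero.endExt hr).le_of_le hx',
        hopen _ _ _ _ h hr (CTree.le_refl _ _)⟩)
      (fun x q' hq' => hdense q' x (QZero.mem_of_le hq' x.2))
    obtain ⟨q', hq', hν⟩ := r.exists_le_lt_g hK hf ν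
    refine ⟨q', hq'.trans hr, fun x hx => ?_, hν⟩
    obtain ⟨x', hx', h'⟩ := h ⟨x, hx⟩
    exact ⟨x', (QZero.endExt hq').le_of_le hx', hopen _ _ _ _ h' hq' (CTree.le_refl _ _)⟩
  choose o ho using fun q : QZero S f => q.exists_bound hK
  obtain ⟨γ, ⟨-, hγS⟩, s, st, h0, hst, hs1, hs2, hst'⟩ :=
    hK.exists_run hS.2.2 (fun _ h => h.1) q o hR
  obtain ⟨w, hw1, -, hw2, hlim, hlt, hlub⟩ := QZero.exists_limit_of_cofinal (p := st)
    (antitone_nat_of_succ_le fun n => (hst n).1) ⟨_, hs1 0⟩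
    (fun n β => (ho _ β).trans (hst' n)) (fun a ha => by
      obtain ⟨n, hn⟩ := hs2 a ha
      obtain ⟨β, hβ⟩ := (hst n).2.2
      exact ⟨n + 1, β, hn.trans_lt hβ⟩)
  obtain ⟨T', h1, h2, h3, h4, -⟩ := w.balanced.exists_extend_through
    (M := {y | Φ w y}) (fun x hx => by
      obtain ⟨n, hn⟩ := hw2 _ (QZero.level_lt_length hx)
      rw [← (st n).height_eq] at hn
      obtain ⟨x', hx', h⟩ := (hst n).2.1 x ((QZero.endExt (hw1 n)).mem_iff.2 ⟨hx, hn⟩)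
      exact ⟨x', hopen _ _ _ _ h (hw1 _) (CTree.le_refl _ _),
        (QZero.endExt (hw1 _)).le_of_le hx'⟩)
  rw [w.height_eq] at h2
  obtain ⟨r, hr, hrl, rfl, -⟩ := QZero.exists_succ w hlt (fun _ => hlub) h1 h2 h3
    (fun h => (hγS h).elim)
  have hne : w.tree.carrier.Nonempty := by
    have hpos : 0 < w.tree.height := by
      rw [w.height_eq]
      exact pos_iff_ne_zero.2 (Ordinal.isSuccLimit_iff.1 hlim).1
    obtain ⟨x, hx, -⟩ := CTree.exists_mem_level_eq hpos
    exact ⟨x, hx⟩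
  refine ⟨r, hr.trans (h0 ▸ hw1 0), w.length, hrl ▸ Order.lt_succ _, fun x hx hxl => ?_⟩
  obtain ⟨y, hy, hyx⟩ := h4 hne x hx (by rw [w.height_eq, hxl])
  exact hopen _ _ _ _ hy hr (Or.inr hyx)

end Sealing

section Souslin

variable {κ : Cardinal.{u}} {S : Set κ.ord.ToType} {f : CTree.{u} → CTree.{u}}
  {p q : QZero S f} {x y : Omega1.{u}}

theorem ForcesMem.mono {Q : Type*} [Preorder Q] {I : Type*} {A : SubsetName Q I} {p q : Q} {i : I}
    (h : ForcesMem p i A) (hq : q ≤ p) : ForcesMem q i A :=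
  fun r hr => h r (hr.trans hq)

theorem exists_mem_tree_of_forcesMem (h : ForcesMem p x (treeName S f)) :
    ∃ q ≤ p, x ∈ q.tree.carrier := by
  obtain ⟨q, hq, s, hs, hqs⟩ := h p le_rfl
  exact ⟨q, hq, QZero.mem_of_le hqs hs⟩

theorem exists_lt_of_forcesMem (h : ForcesMem p (x, y) (treeOrderName S f)) :
    ∃ q ≤ p, q.tree.lt x y := by
  obtain ⟨q, hq, s, hs, hqs⟩ := h p le_rfl
  exact ⟨q, hq, QZero.lt_of_le hqs hs⟩

theorem forcesMem_of_lt (h : p.tree.lt x y) : ForcesMem p (x, y) (treeOrderName S f) :=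
  fun q hq => ⟨q, le_rfl, q, QZero.lt_of_le hq h, le_rfl⟩

/-- A name for a subset of the tree is forced to be countable if densely often some level is such
that no node above it can be forced into the subset. -/
theorem forcesCountable_of_sealed {A : SubsetName (QZero S f) Omega1.{u}}
    (hA : ForcesSubsetTree p A)
    (h : ∀ q ≤ p, ∃ r ≤ q, ∃ α < r.length, ∀ z ∈ r.tree.carrier, r.tree.level z = α →
      ∀ s ≤ r, ∀ y, s.tree.lt z y → ¬ ForcesMem s y A) :
    ForcesCountable p A := by
  intro q hq
  obtain ⟨r, hr, α, hα, hz⟩ := h q hq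
  refine ⟨r, hr, r.tree.carrier, r.tree.countable, fun s hs y hy => ?_⟩
  by_contra hyr
  obtain ⟨t, ht, hyt⟩ := exists_mem_tree_of_forcesMem (hA s (hs.trans (hr.trans hq)) y hy)
  have htr := ht.trans hs
  have hl : r.length ≤ t.tree.level y := by
    by_contra! hl
    rw [← r.height_eq] at hl
    exact hyr ((QZero.endExt htr).mem_iff.2 ⟨hyt, hl⟩)
  obtain ⟨z, hzy, hzl⟩ := CTree.exists_lt_level_eq (hα.trans_le hl)
  have hzr : z ∈ r.tree.carrier := (QZero.endExt htr).mem_iff.2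
    ⟨(t.tree.mem_of_lt hzy).1, by rwa [hzl, r.height_eq]⟩
  refine hz z hzr ?_ t htr y hzy (hy.mono ht)
  rw [← (QZero.endExt htr).level_eq hzr, hzl]

variable (hK : IsRegularUncountable κ.ord.ToType) (hf : IsCoding f) (hS : IsStatCostat S)
include hK hf hS

theorem forcesCountable_of_forcesAntichain {A : SubsetName (QZero S f) Omega1.{u}}
    (hA : ForcesAntichain p A) : ForcesCountable p A := by
  refine forcesCountable_of_sealed hA.1 fun q hq => ?_
  -- the pairs that decide whether some node of `A` is comparable with an extension of `x`
  obtain ⟨r, hr, α, hα, h⟩ := exists_sealed hK hf hS (q := q)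
    (Φ := fun q x => (∃ y, q.tree.le y x ∧ ForcesMem q y A) ∨
      ∀ q' ≤ q, ∀ x', q'.tree.le x x' → ∀ y, q'.tree.le y x' → ¬ ForcesMem q' y A)
    (by
      rintro q q' x x' (⟨y, hy, h⟩ | h) hq hx
      · exact Or.inl ⟨y, CTree.le_trans ((QZero.endExt hq).le_of_le hy) hx, h.mono hq⟩
      · refine Or.inr fun q'' hq' x'' hx' => h q'' (hq'.trans hq) x'' ?_
        exact CTree.le_trans ((QZero.endExt hq').le_of_le hx) hx')
    (by
      intro q x hx
      by_cases h : ∀ q' ≤ q, ∀ x', q'.tree.le x x' → ∀ y, q'.tree.le y x' → ¬ ForcesMem q' y A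
      · exact ⟨q, le_rfl, x, CTree.le_refl _ _, Or.inr h⟩
      · push Not at h
        obtain ⟨q', hq', x', hx', y, hy, hyA⟩ := h
        exact ⟨q', hq', x', hx', Or.inl ⟨y, hy, hyA⟩⟩)
  refine ⟨r, hr, α, hα, fun z hz hzl s hs y hzy hy => ?_⟩
  rcases h z hz hzl with ⟨w, hw, hwA⟩ | h
  · exact hA.2 s (hs.trans (hr.trans hq)) w y (hwA.mono hs) hy
      (forcesMem_of_lt (CTree.lt_of_le_of_lt ((QZero.endExt hs).le_of_le hw) hzy))
  · exact h s hs y (Or.inr hzy) y (CTree.le_refl _ _) hy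

theorem forcesCountable_of_forcesChain {A : SubsetName (QZero S f) Omega1.{u}}
    (hA : ForcesChain p A) : ForcesCountable p A := by
  refine forcesCountable_of_sealed hA.1 fun q hq => ?_
  -- the pairs that forbid `A` to have a node above `x`; they are dense because `x` can be split
  obtain ⟨r, hr, α, hα, h⟩ := exists_sealed hK hf hS (q := q)
    (Φ := fun q x => ∀ q' ≤ q, q' ≤ p → ∀ y, q'.tree.le x y → ¬ ForcesMem q' y A)
    (by
      intro q q' x x' h hq hx q'' hq' hp y hy
      exact h q'' (hq'.trans hq) hp y
        (CTree.le_trans ((QZero.endExt hq').le_of_le hx) hy))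
    (by
      intro q x hx
      by_cases hc : ∃ q' ≤ q, q' ≤ p
      · obtain ⟨q₁, hq₁, hp₁⟩ := hc
        obtain ⟨q₂, hq₂, hsplit⟩ := q₁.exists_le_split hK hf hS.1
        obtain ⟨z, z', hz, hz', hn, hn'⟩ := hsplit x (QZero.mem_of_le hq₁ hx)
        have hmz := (q₂.tree.mem_of_lt hz).2
        have hmz' := (q₂.tree.mem_of_lt hz').2
        by_contra! hcon
        have h₁ := hcon q₂ (hq₂.trans hq₁) z (Or.inr hz)
        obtain ⟨q₃, hq₃, hp₃, y, hy, hyA⟩ := h₁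
        obtain ⟨q₄, hq₄, hp₄, y', hy', hyA'⟩ := hcon q₃ (hq₃.trans (hq₂.trans hq₁)) z'
          ((QZero.endExt hq₃).le_of_le (Or.inr hz'))
        have hinc : ∀ t ≤ q₂, ∀ w, t.tree.le z w → ¬ t.tree.le z' w := fun t ht w =>
          QZero.not_le_of_incomparable ht hmz hmz' hn hn'
        have hq42 := hq₄.trans hq₃
        have hzy := (QZero.endExt hq₄).le_of_le hy
        have hne : y ≠ y' := fun h => hinc q₄ hq42 y hzy (h ▸ hy')
        obtain ⟨t, ht, h | h⟩ := hA.2 q₄ hp₄ y y' (hyA.mono hq₄) hyA' hne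
        · obtain ⟨t', ht', hlt⟩ := exists_lt_of_forcesMem h
          have ht4 := ht'.trans ht
          exact hinc t' (ht4.trans hq42) y'
            (CTree.le_trans ((QZero.endExt ht4).le_of_le hzy) (Or.inr hlt))
            ((QZero.endExt ht4).le_of_le hy')
        · obtain ⟨t', ht', hlt⟩ := exists_lt_of_forcesMem h
          have ht4 := ht'.trans ht
          exact hinc t' (ht4.trans hq42) y ((QZero.endExt ht4).le_of_le hzy)
            (CTree.le_trans ((QZero.endExt ht4).le_of_le hy') (Or.inr hlt))
      · exact ⟨q, le_rfl, x, CTree.le_refl _ _, fun q' hq' hp => (hc ⟨q', hq', hp⟩).elim⟩)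
  exact ⟨r, hr, α, hα, fun z hz hzl s hs y hzy hy =>
    h z hz hzl s hs (hs.trans (hr.trans hq)) y (Or.inr hzy) hy⟩

theorem forcesSouslinTree : ForcesSouslinTree S f := by
  refine ⟨fun p α hα => ?_, fun p A => forcesCountable_of_forcesAntichain hK hf hS,
    fun p A => forcesCountable_of_forcesChain hK hf hS⟩
  obtain ⟨q, hq, h⟩ := p.exists_le_lt_length hK hf hα
  exact ⟨q, hq, q.height_eq ▸ h⟩

end Souslin

/-! ### Regular open algebras -/

section RegularOpen

universe v

variable {P : Type v} [Preorder P] {b b' : RegularOpenAlgebra P} {c d : P}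

/-- The condition `c` belongs to the regular open set `b`, that is, `c` forces `b` into the generic
filter. -/
def InRegular (c : P) (b : RegularOpenAlgebra P) : Prop := c ∈ (b : LowerSet P)

theorem InRegular.mono (h : InRegular c b) (hd : d ≤ c) : InRegular d b :=
  (b : LowerSet P).lower hd h

theorem InRegular.of_le (h : InRegular c b) (hb : b ≤ b') : InRegular c b' := by
  have : (b : LowerSet P) ≤ (b' : LowerSet P) := Heyting.Regular.coe_le_coe.2 hb
  exact this h

/-- The regular open set generated by a condition. -/
noncomputable def principal (c : P) : RegularOpenAlgebra P :=
  Heyting.Regular.toRegular (LowerSet.Iic c)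

theorem principal_le_iff : principal c ≤ b ↔ InRegular c b := by
  rw [principal, Heyting.Regular.gi.gc _ _]
  exact LowerSet.Iic_le

theorem inRegular_principal (c : P) : InRegular c (principal c) := principal_le_iff.1 le_rfl

/-- A member of the regular open set generated by `c` is compatible with `c`. -/
theorem InRegular.exists_le (h : InRegular d (principal c)) : ∃ e ≤ d, e ≤ c := by
  by_contra! hcon
  have h1 : LowerSet.Iic d ≤ (LowerSet.Iic c)ᶜ := by
    rw [le_compl_iff_disjoint_right, disjoint_iff_inf_le]
    intro e he
    exact (hcon e he.1 he.2).elim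
  have h2 : LowerSet.Iic d ≤ (LowerSet.Iic c)ᶜᶜ := LowerSet.Iic_le.2 h
  have h3 := le_inf h1 h2
  rw [inf_compl_self] at h3
  exact h3 (show d ∈ LowerSet.Iic d from le_rfl)

theorem ne_bot_iff : b ≠ ⊥ ↔ ∃ c, InRegular c b := by
  constructor
  · intro h
    by_contra! hcon
    refine h (le_bot_iff.1 ?_)
    rw [← Heyting.Regular.coe_le_coe]
    intro c hc
    exact (hcon c hc).elim
  · rintro ⟨c, hc⟩ rfl
    exact hc

theorem principal_ne_bot (c : P) : principal c ≠ ⊥ := ne_bot_iff.2 ⟨c, inRegular_principal c⟩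

theorem InRegular.inf (h : InRegular c b) (h' : InRegular c b') : InRegular c (b ⊓ b') :=
  principal_le_iff.1 (le_inf (principal_le_iff.2 h) (principal_le_iff.2 h'))

theorem exists_inRegular_or_compl (c : P) (b : RegularOpenAlgebra P) :
    ∃ d ≤ c, InRegular d b ∨ InRegular d bᶜ := by
  by_cases h : ∃ d ≤ c, InRegular d b
  · obtain ⟨d, hd, h⟩ := h
    exact ⟨d, hd, Or.inl h⟩
  · push Not at h
    refine ⟨c, le_rfl, Or.inr (principal_le_iff.1 ?_)⟩
    rw [le_compl_iff_disjoint_right, disjoint_iff]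
    by_contra hne
    obtain ⟨d, hd⟩ := ne_bot_iff.1 hne
    obtain ⟨e, he, hec⟩ := (hd.of_le inf_le_left).exists_le
    exact h e hec ((hd.of_le inf_le_right).mono he)

end RegularOpen

/-! ### Clubs of countable sets -/

theorem exists_forall_mem_of_monotone {X : Type*} {N : ℕ → Set X} (hN : Monotone N) {l : List X}
    (hl : ∀ i ∈ l, i ∈ ⋃ n, N n) : ∃ n, ∀ i ∈ l, i ∈ N n := by
  induction l with
  | nil => exact ⟨0, by simp⟩
  | cons j l ih =>
    obtain ⟨m, hm⟩ := ih fun i hi => hl i (List.mem_cons_of_mem _ hi)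
    obtain ⟨n, hn⟩ := Set.mem_iUnion.1 (hl j List.mem_cons_self)
    refine ⟨max m n, fun i hi => ?_⟩
    rcases List.mem_cons.1 hi with rfl | hi
    · exact hN (le_max_right m n) hn
    · exact hN (le_max_left m n) (hm i hi)

/-- The countable sets closed under a finitary operation with countable values form a club. -/
theorem isClubOfCountable_closed {X : Type*} (F : List X → Set X) (hF : ∀ l, (F l).Countable) :
    IsClubOfCountable {N : Set X | N.Countable ∧ ∀ l : List X, (∀ i ∈ l, i ∈ N) → F l ⊆ N} := by
  refine ⟨fun N hN => hN.1, fun M hM => ?_,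
    fun N hN h => ⟨Set.countable_iUnion fun n => (h n).1, ?_⟩⟩
  · let G : Set X → Set X := fun N => N ∪ ⋃ l : List N, F (l.map Subtype.val)
    let N : ℕ → Set X := fun n => G^[n] M
    have hN : ∀ n, N (n + 1) = G (N n) := fun n => Function.iterate_succ_apply' G n M
    have hmono : Monotone N := monotone_nat_of_le_succ fun n => by
      rw [hN]
      exact Set.subset_union_left
    have hc : ∀ n, (N n).Countable := fun n => by
      induction n with
      | zero => exact hM
      | succ n ih =>
        rw [hN]
        have := ih.to_subtype
        exact ih.union (Set.countable_iUnion fun l => hF _)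
    refine ⟨⋃ n, N n, ⟨Set.countable_iUnion hc, fun l hl => ?_⟩, Set.subset_iUnion N 0⟩
    obtain ⟨n, hn⟩ := exists_forall_mem_of_monotone hmono hl
    refine subset_trans ?_ (Set.subset_iUnion N (n + 1))
    rw [hN]
    refine subset_trans ?_ Set.subset_union_right
    have h := Set.subset_iUnion (fun l : List (N n) => F (l.map Subtype.val))
      (l.attachWith (· ∈ N n) hn)
    rwa [List.attachWith_map_subtype_val] at h
  · intro l hl
    obtain ⟨n, hn⟩ := exists_forall_mem_of_monotone hN hl
    exact ((h n).2 l hn).trans (Set.subset_iUnion N n)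

/-! ### Properness -/

theorem QZero.exists_length_eq_zero {κ : Cardinal.{u}} {S : Set κ.ord.ToType}
    {f : CTree.{u} → CTree.{u}} : ∃ q : QZero S f, q.length = 0 := by
  let T : CTree.{u} :=
    { carrier := ∅
      countable := Set.countable_empty
      lt := fun _ _ => False
      mem_of_lt := False.elim
      lt_trans := fun h _ => h.elim
      wf := ⟨fun x => ⟨x, fun _ h => h.elim⟩⟩
      linear := fun h _ => h.elim }
  have hT : T.height = 0 := le_antisymm
    (CTree.height_le_iff.2 fun x hx => (Set.notMem_empty x hx).elim) zero_le
  have h0 : ∀ β : Set.Iio (0 : Ordinal.{u}), False := fun β => not_lt_zero (show β.1 < 0 from β.2)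
  exact ⟨⟨0, omega_pos 1, fun β => (h0 β).elim, fun β => (h0 β).elim, fun β => (h0 β).elim, T,
    fun x hx => (Set.notMem_empty x hx).elim, hT, fun β => (h0 β).elim⟩, rfl⟩

section Proper

variable {κ : Cardinal.{u}} {S : Set κ.ord.ToType} {f : CTree.{u} → CTree.{u}}

/-- The condition given by `q` and the node `x` of its tree belongs to `b`. -/
def InAt (b : RegularOpenAlgebra (CodedSouslin S f)) (q : QZero S f) (x : Omega1.{u}) : Prop :=
  ∃ h : x ∈ q.tree.carrier, InRegular ⟨q, x, h⟩ b

variable {b b' : RegularOpenAlgebra (CodedSouslin S f)} {q q' : QZero S f} {x x' : Omega1.{u}}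

theorem InAt.mono (h : InAt b q x) (hq : q' ≤ q) (hx : q'.tree.le x x') : InAt b q' x' := by
  obtain ⟨hm, h⟩ := h
  exact ⟨CTree.mem_of_le' hx (QZero.mem_of_le hq hm), h.mono ⟨hq, hx⟩⟩

theorem InAt.of_le (h : InAt b q x) (hb : b ≤ b') : InAt b' q x :=
  ⟨h.1, h.2.of_le hb⟩

theorem exists_inAt (hb : b ≠ ⊥) : ∃ q x, InAt b q x := by
  obtain ⟨⟨q, x, hx⟩, h⟩ := ne_bot_iff.1 hb
  exact ⟨q, x, hx, h⟩

theorem InAt.ne_bot (h : InAt b q x) : b ≠ ⊥ := ne_bot_iff.2 ⟨_, h.2⟩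

theorem InAt.inf (h : InAt b q x) (h' : InAt b' q x) : InAt (b ⊓ b') q x :=
  ⟨h.1, h.2.inf h'.2⟩

/-- A nonzero element below the one generated by `(q, x)` contains an extension of `(q, x)`. -/
theorem exists_inAt_of_le_principal {hx : x ∈ q.tree.carrier} (hb : b ≠ ⊥)
    (hle : b ≤ principal (⟨q, x, hx⟩ : CodedSouslin S f)) :
    ∃ q' ≤ q, ∃ x', q'.tree.le x x' ∧ InAt b q' x' := by
  obtain ⟨c, hc⟩ := ne_bot_iff.1 hb
  obtain ⟨⟨q', x', hx'⟩, he, hle⟩ := (hc.of_le hle).exists_le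
  exact ⟨q', hle.1, x', hle.2, hx', hc.mono he⟩

variable (hK : IsRegularUncountable κ.ord.ToType) (hf : IsCoding f) (hS : IsStatCostat S)

include hK hf hS in
/-- The algebra is proper. The finite sequences `l` of members of `N` index conditions `cond p l` of
`Q₀` that seal the dense sets in `l`; if `N` contains the elements of these dense sets on the
sealed, countable levels, then a lower bound of `cond p l` along an enumeration of `N` is generic
over `N` together with any node. -/
theorem isProper : IsProper (RegularOpenAlgebra (CodedSouslin S f)) := by
  set B := RegularOpenAlgebra (CodedSouslin S f)
  have hseal : ∀ (D : Set B) (q : QZero S f), ∃ r ≤ q, IsDenseSet D → ∃ α < r.length,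
      ∀ x ∈ r.tree.carrier, r.tree.level x = α → ∃ d ∈ D, InAt d r x := by
    intro D q
    by_cases hD : IsDenseSet D
    · obtain ⟨r, hr, h⟩ := exists_sealed hK hf hS (Φ := fun q x => ∃ d ∈ D, InAt d q x)
        (fun q q' x x' ⟨d, hd, h⟩ hq hx => ⟨d, hd, h.mono hq hx⟩)
        (fun q x hx => by
          obtain ⟨d, hd, hle⟩ := hD.2 _ (principal_ne_bot (⟨q, x, hx⟩ : CodedSouslin S f))
          obtain ⟨q', hq', x', hx', h⟩ := exists_inAt_of_le_principal (hD.1 d hd) hle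
          exact ⟨q', hq', x', hx', d, hd, h⟩) q
      exact ⟨r, hr, fun _ => h⟩
    · exact ⟨q, le_rfl, fun h => (hD h).elim⟩
  choose sl hsl1 hsl2 using hseal
  have hpick : ∀ (D : Set B) (r : QZero S f) (x : Omega1.{u}), ∃ d : B,
      (∃ d ∈ D, InAt d r x) → d ∈ D ∧ InAt d r x := by
    intro D r x
    by_cases h : ∃ d ∈ D, InAt d r x
    · obtain ⟨d, hd⟩ := h
      exact ⟨d, fun _ => hd⟩
    · exact ⟨⊥, fun h' => (h h').elim⟩
  choose pick hpick using hpick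
  have hstart : ∀ p : B, ∃ q : QZero S f, p ≠ ⊥ → ∃ x, InAt p q x := by
    intro p
    by_cases h : p = ⊥
    · obtain ⟨q, -⟩ := QZero.exists_length_eq_zero (S := S) (f := f)
      exact ⟨q, fun h' => (h' h).elim⟩
    · obtain ⟨q, h⟩ := exists_inAt h
      exact ⟨q, fun _ => h⟩
  choose start hstart using hstart
  -- in lists of members of `B ⊕ Set B`, later elements come first and members of `B` are skipped
  let step : B ⊕ Set B → QZero S f → QZero S f := fun i q => i.elim (fun _ => q) (fun D => sl D q)
  let cond : B → List (B ⊕ Set B) → QZero S f := fun p l => l.foldr step (start p)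
  let F : List (B ⊕ Set B) → Set (B ⊕ Set B) := fun l => match l with
    | Sum.inl p :: Sum.inr D :: l =>
      (fun x => Sum.inl (pick D (sl D (cond p l)) x)) '' (sl D (cond p l)).tree.carrier
    | _ => ∅
  have hF : ∀ l, (F l).Countable := by
    intro l
    simp only [F]
    split
    · exact (CTree.countable _).image _
    · exact Set.countable_empty
  -- `N` is enumerated by `e`, and `l n` lists the first `n` members
  refine ⟨_, isClubOfCountable_closed F hF, fun N hN p hp hpN => ?_⟩
  obtain ⟨e, rfl⟩ := hN.1.exists_eq_range ⟨_, hpN⟩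
  let l : ℕ → List (B ⊕ Set B) := fun n => Nat.rec [] (fun n l => e n :: l) n
  have hl : ∀ n, ∀ i ∈ l n, i ∈ Set.range e := by
    intro n
    induction n with
    | zero => simp [l]
    | succ n ih =>
      intro i hi
      rcases List.mem_cons.1 hi with rfl | hi
      · exact ⟨n, rfl⟩
      · exact ih i hi
  have hanti : Antitone fun n => cond p (l n) := by
    refine antitone_nat_of_succ_le fun n => ?_
    change step (e n) (cond p (l n)) ≤ cond p (l n)
    rcases e n with b | D
    · exact le_rfl
    · exact hsl1 D _
  obtain ⟨w, hw, -⟩ := QZero.exists_limit hanti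
  obtain ⟨x₀, hx₀⟩ := hstart p hp
  have hpw : InAt p w x₀ := hx₀.mono (hw 0) (CTree.le_refl _ _)
  refine ⟨principal ⟨w, x₀, hpw.1⟩, principal_le_iff.2 hpw.2, principal_ne_bot _, ?_⟩
  rintro D ⟨k, hk⟩ hD r hr hr0
  obtain ⟨q', hq', x', -, hrx⟩ := exists_inAt_of_le_principal hr0 hr
  have hsw : w ≤ sl D (cond p (l k)) := by
    have := hw (k + 1)
    change w ≤ step (e k) (cond p (l k)) at this
    rwa [hk] at this
  obtain ⟨α, hα, h⟩ := hsl2 D (cond p (l k)) hD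
  obtain ⟨q₂, hq₂, -, x₂, -, hx₂, hα₂⟩ := QZero.exists_le_level hK hf hrx.1
    (hα.trans (QZero.length_lt _))
  obtain ⟨z, hz, hzl⟩ := CTree.exists_le_level_eq hα₂
  have hs2 := hq₂.trans (hq'.trans hsw)
  have hzs : z ∈ (sl D (cond p (l k))).tree.carrier := (QZero.endExt hs2).mem_iff.2
    ⟨CTree.mem_of_le hz (CTree.mem_of_le' hx₂ (QZero.mem_of_le hq₂ hrx.1)), by
      rwa [hzl, QZero.height_eq]⟩
  obtain ⟨hd, hdz⟩ := hpick _ _ _ (h z hzs (by rw [← (QZero.endExt hs2).level_eq hzs, hzl]))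
  refine ⟨_, hd, ?_, ((hdz.mono hs2 hz).inf (hrx.mono hq₂ hx₂)).ne_bot⟩
  have hsub := hN.2 (Sum.inl p :: Sum.inr D :: l k) (by
    intro i hi
    rcases List.mem_cons.1 hi with rfl | hi
    · exact hpN
    rcases List.mem_cons.1 hi with rfl | hi
    · exact ⟨k, hk⟩
    · exact hl k i hi)
  exact hsub ⟨z, hzs, rfl⟩

end Proper

/-! ### Density -/

section Density

variable {κ : Cardinal.{u}} {S : Set κ.ord.ToType} {f : CTree.{u} → CTree.{u}}

/-- A condition of `Q₀` is determined by the range of `g` and the tree. -/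
theorem QZero.ext_of_range {p q : QZero S f} (hg : Set.range p.g = Set.range q.g)
    (hT : p.tree = q.tree) : p = q := by
  obtain ⟨l, _, g, hg1, _, T, _, h, _⟩ := p
  obtain ⟨l', _, g', hg1', _, T', _, h', _⟩ := q
  simp only at hT hg
  subst hT
  obtain rfl : l = l' := h.symm.trans h'
  obtain rfl : g = g' := (StrictMono.range_inj hg1 hg1').1 hg
  rfl

theorem mk_codedSouslin_le (hK : IsRegularUncountable κ.ord.ToType) (hκ : IsStrongPrelimit κ) :
    #(CodedSouslin S f) ≤ Cardinal.lift.{u + 1} κ := by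
  have h0 : ℵ₀ < κ := by simpa using hK.aleph0_lt
  let Y := {s : Set κ.ord.ToType // Set.Bounded (· < ·) s} ×
    Set Omega1.{u} × Set (Omega1.{u} × Omega1.{u}) × Omega1.{u}
  let F : CodedSouslin S f → Y := fun c => ⟨⟨Set.range c.base.g, by
      obtain ⟨a, ha⟩ := c.base.exists_bound hK
      exact ⟨a, by rintro _ ⟨β, rfl⟩; exact ha β⟩⟩,
    c.base.tree.carrier, {x | c.base.tree.lt x.1 x.2}, c.node⟩
  have hF : F.Injective := by
    rintro ⟨q, x, hx⟩ ⟨q', x', hx'⟩ h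
    have h1 : Set.range q.g = Set.range q'.g := congrArg (fun y : Y => y.1.1) h
    have h2 : q.tree.carrier = q'.tree.carrier := congrArg (fun y : Y => y.2.1) h
    have h3 : {x : Omega1.{u} × Omega1.{u} | q.tree.lt x.1 x.2} = {x | q'.tree.lt x.1 x.2} :=
      congrArg (fun y : Y => y.2.2.1) h
    obtain rfl : x = x' := congrArg (fun y : Y => y.2.2.2) h
    obtain rfl : q = q' := by
      refine QZero.ext_of_range h1 (CTree.ext h2 ?_)
      funext x y
      exact propext (Set.ext_iff.1 h3 (x, y))
    rfl
  have h1 : ℵ₁ < κ := by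
    have : ℵ₁ ≤ 2 ^ ℵ₀ := by
      rw [← succ_aleph0]
      exact Order.succ_le_of_lt (cantor ℵ₀)
    exact this.trans_lt (hκ h0)
  have h2 := hκ h1
  have hΩ : #Omega1.{u} = ℵ₁ := by
    rw [Omega1, ← ord_aleph, mk_ord_toType]
  have hbd : #{s : Set κ.ord.ToType // Set.Bounded (· < ·) s} = κ := by
    rw [mk_bounded_subset (by rwa [mk_ord_toType]) (by simp), mk_ord_toType]
  have hY : #Y ≤ κ := by
    simp only [Y, mk_prod, Cardinal.lift_id, mk_set, hbd, hΩ, aleph_mul_aleph, max_self]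
    exact mul_le_of_le h0.le le_rfl (mul_le_of_le h0.le h2.le (mul_le_of_le h0.le h2.le h1.le))
  have h := (Cardinal.lift_mk_le_lift_mk_of_injective hF).trans (Cardinal.lift_le.2 hY)
  rwa [Cardinal.lift_id'.{u, u + 1}] at h

theorem exists_first_value (hf : IsCoding f) (a : κ.ord.ToType) :
    ∃ (c : CodedSouslin S f) (h : 0 < c.base.length), c.base.g ⟨0, h⟩ = a := by
  obtain ⟨q₀, h0⟩ := QZero.exists_length_eq_zero (S := S) (f := f)
  have hemp : ∀ β : Set.Iio q₀.length, False := fun β =>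
    not_lt_zero (show β.1 < 0 from h0 ▸ β.2)
  obtain ⟨q, -, hql, ⟨β, hβl⟩, hβ⟩ := QZero.exists_succ_coded hf q₀ (ν := a)
    (fun β => (hemp β).elim) (fun h => ((Ordinal.isSuccLimit_iff.1 h).1 h0).elim)
  rw [h0] at hql
  have hpos : 0 < q.tree.height := by
    rw [q.height_eq, hql]
    exact Order.lt_succ 0
  obtain ⟨x, hx, -⟩ := CTree.exists_mem_level_eq hpos
  obtain rfl : β = 0 := by
    have h' : β < Order.succ 0 := hql ▸ hβl
    simpa using h'
  exact ⟨⟨q, x, hx⟩, hβl, hβ⟩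

/-- The density is at least `κ`: fewer than `κ` conditions only mention boundedly many ordinals,
whereas the first value of `g` can be chosen above all of them. -/
theorem density_eq (hK : IsRegularUncountable κ.ord.ToType) (hκ : IsStrongPrelimit κ)
    (hf : IsCoding f) :
    density (RegularOpenAlgebra (CodedSouslin S f)) = Cardinal.lift.{u + 1} κ := by
  have hup : IsDenseSet (Set.range (principal : CodedSouslin S f → _)) := by
    refine ⟨?_, fun b hb => ?_⟩
    · rintro _ ⟨c, rfl⟩
      exact principal_ne_bot c
    · obtain ⟨c, hc⟩ := ne_bot_iff.1 hb
      exact ⟨_, ⟨c, rfl⟩, principal_le_iff.2 hc⟩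
  apply le_antisymm
  · have h : density (RegularOpenAlgebra (CodedSouslin S f)) ≤
        #(Set.range (principal : CodedSouslin S f → _)) := csInf_le' ⟨_, hup, rfl⟩
    exact h.trans (mk_range_le.trans (mk_codedSouslin_le hK hκ))
  · rw [density]
    refine le_csInf ?_ ?_
    · exact ⟨_, _, hup, rfl⟩
    rintro _ ⟨D, hD, rfl⟩
    by_contra! hlt
    choose c hc using fun d : D => ne_bot_iff.1 (hD.1 d d.2)
    choose o ho using fun q : QZero S f => q.exists_bound hK
    obtain ⟨a, ha⟩ := hK.exists_bound (Set.range fun d => o (c d).base) (by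
      have h := Cardinal.mk_range_le_lift (f := fun d => o (c d).base)
      rw [← Cardinal.lift_lt.{u, u + 1}]
      rw [Cardinal.lift_id'.{u, u + 1}] at h
      rw [mk_ord_toType]
      exact h.trans_lt hlt)
    obtain ⟨c', h0, hc'⟩ := exists_first_value (S := S) hf a
    obtain ⟨d, hd, hle⟩ := hD.2 _ (principal_ne_bot c')
    obtain ⟨e, he, heq⟩ := ((hc ⟨d, hd⟩).of_le hle).exists_le
    have hcl : 0 < (c ⟨d, hd⟩).base.length :=
      pos_of_gt (QZero.level_lt_length (c ⟨d, hd⟩).node_mem)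
    have h1 := QZero.g_eq heq.1 (h0.trans_le (QZero.length_le heq.1)) h0
    have h2 := QZero.g_eq he.1 (h0.trans_le (QZero.length_le heq.1)) hcl
    have h3 := ho _ ⟨0, hcl⟩
    rw [← h2, h1] at h3
    exact (h3.trans (ha _ ⟨⟨d, hd⟩, rfl⟩)).ne hc'

end Density

/-! ### The cut-and-choose game -/

theorem movesUpTo_eq {B : Type*} (b : ℕ → B) (n : ℕ) :
    movesUpTo b n = (List.range' 0 (n + 1)).map b := by
  apply List.ext_getElem
  · simp [movesUpTo]
  · intro i h h'
    simp [movesUpTo, -List.ofFn_succ]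

section Iterated

variable {K P B : Type*} (U : Ultrafilter K) (step : P → B → K → P)

/-- Starting from `c`, for `U`-almost all `ν₀`, for `U`-almost all `ν₁`, …, the condition reached by
the steps with moves `l` and parameters `ν₀, ν₁, …` satisfies `φ`. -/
def AlmostAll : P → List B → (P → Prop) → Prop
  | c, [], φ => φ c
  | c, b :: l, φ => ∀ᶠ ν in (U : Filter K), AlmostAll (step c b ν) l φ

variable {U step}

theorem AlmostAll.mono {φ ψ : P → Prop} (h : ∀ c, φ c → ψ c) :
    ∀ {l : List B} {c : P}, AlmostAll U step c l φ → AlmostAll U step c l ψ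
  | [], _, hc => h _ hc
  | _ :: _, _, hc => Filter.Eventually.mono hc fun _ h' => AlmostAll.mono h h'

theorem AlmostAll.not {φ : P → Prop} :
    ∀ {l : List B} {c : P}, ¬ AlmostAll U step c l φ → AlmostAll U step c l fun c => ¬ φ c
  | [], _, hc => hc
  | _ :: _, _, hc => Filter.Eventually.mono (Ultrafilter.eventually_not.2 hc)
      fun _ h' => AlmostAll.not h'

theorem AlmostAll.and {φ ψ : P → Prop} :
    ∀ {l : List B} {c : P}, AlmostAll U step c l φ → AlmostAll U step c l ψ →
      AlmostAll U step c l fun c => φ c ∧ ψ c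
  | [], _, h, h' => ⟨h, h'⟩
  | _ :: _, _, h, h' => by
    filter_upwards [h, h'] with ν h h' using AlmostAll.and h h'

theorem AlmostAll.concat {φ : P → Prop} {b : B} (h : ∀ c ν, φ (step c b ν)) :
    ∀ {l : List B} {c : P}, AlmostAll U step c (l ++ [b]) φ
  | [], c => Filter.Eventually.of_forall fun ν => h c ν
  | _ :: _, _ => Filter.Eventually.of_forall fun _ => AlmostAll.concat h

end Iterated

section CutAndChoose

variable {κ : Cardinal.{u}} {S : Set κ.ord.ToType} {f : CTree.{u} → CTree.{u}}
  (hK : IsRegularUncountable κ.ord.ToType) (hf : IsCoding f) (hS : IsStatCostat S)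

include hK hf in
/-- Below every condition there is one that decides `b`, mentions an ordinal above `ν`, and has its
node above the tree of the given condition. -/
theorem exists_deciding (c : CodedSouslin S f) (b : RegularOpenAlgebra (CodedSouslin S f))
    (ν : κ.ord.ToType) :
    ∃ c' ≤ c, (InRegular c' b ∨ InRegular c' bᶜ) ∧ (∃ β, ν < c'.base.g β) ∧
      c.base.length ≤ c'.base.tree.level c'.node := by
  obtain ⟨q₁, hq₁, ⟨β, hβ⟩, hν⟩ := c.base.exists_le_lt_g hK hf ν
  obtain ⟨q₂, hq₂, -, x, hx, hcx, hl⟩ := QZero.exists_le_level hK hf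
    (QZero.mem_of_le hq₁ c.node_mem) c.base.length_lt
  obtain ⟨d, hd, hdec⟩ := exists_inRegular_or_compl (⟨q₂, x, hx⟩ : CodedSouslin S f) b
  have h2 : (⟨q₂, x, hx⟩ : CodedSouslin S f) ≤ c := ⟨hq₂.trans hq₁, hcx⟩
  have h1 : d.base ≤ q₁ := le_trans hd.1 hq₂
  refine ⟨d, hd.trans h2, hdec, ⟨⟨β, lt_of_lt_of_le hβ (QZero.length_le h1)⟩, ?_⟩, ?_⟩
  · rwa [QZero.g_eq h1 _ hβ]
  · refine hl.trans ?_
    rw [← (QZero.endExt hd.1).level_eq hx]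
    exact CTree.level_le hd.2

/-- A descending sequence of conditions whose nodes climb to the height of the union of the trees,
and whose values of `g` have their supremum outside of `S`, has a lower bound: a node can be added
above the branch given by the sequence. -/
theorem exists_lower_bound {c : ℕ → CodedSouslin S f} (hc : Antitone c)
    (hl : ∀ n, (c n).base.length ≤ (c (n + 1)).base.tree.level (c (n + 1)).node)
    {γ : κ.ord.ToType} (hγS : γ ∉ S) (hγ : ∃ a, a < γ) (hb : ∀ n β, (c n).base.g β < γ)
    (hcof : ∀ a < γ, ∃ n β, a < (c n).base.g β) : ∃ d, ∀ n, d ≤ c n := by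
  obtain ⟨w, hw1, -, hw2, -, hlt, hlub⟩ := QZero.exists_limit_of_cofinal
    (p := fun n => (c n).base) (fun m n h => (hc h).1) hγ hb hcof
  have hbr : w.tree.IsCofinalBranch {x | ∃ n, w.tree.le x (c n).node} := by
    refine CTree.isCofinalBranch_of_seq (fun n => QZero.mem_of_le (hw1 n) (c n).node_mem)
      (fun n => (QZero.endExt (hw1 (n + 1))).le_of_le (hc n.le_succ).2) fun α hα => ?_
    rw [w.height_eq] at hα
    obtain ⟨n, hn⟩ := hw2 α hα
    refine ⟨n + 1, hn.le.trans ((hl n).trans_eq ?_)⟩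
    exact ((QZero.endExt (hw1 (n + 1))).level_eq (c (n + 1)).node_mem).symm
  obtain ⟨T', h1, h2, h3, z, hz, -, h4⟩ := w.balanced.exists_extend_branch hbr
  rw [w.height_eq] at h2
  obtain ⟨r, hr, -, rfl, -⟩ := QZero.exists_succ w hlt (fun _ => hlub) h1 h2 h3
    (fun h => (hγS h).elim)
  exact ⟨⟨r, z, hz⟩, fun n => ⟨hr.trans (hw1 n), Or.inr (h4 _ ⟨n, CTree.le_refl _ _⟩)⟩⟩

include hK hf hS in
/-- Player II wins the cut-and-choose game. Player II attaches to finite sequences `s` of ordinals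
conditions that decide the moves of player I, and answers according to the decision made for almost
all `s`. In the end the sequences `s` along which all conditions agree with the answers form a tree
that branches on sets in the ultrafilter, and a branch of this tree can be chosen whose conditions
have a lower bound. -/
theorem winsCutAndChoose {U : Ultrafilter κ.ord.ToType}
    (hU : CountableInterFilter (U : Filter κ.ord.ToType))
    (hU' : ∀ A ∈ U, ∀ a, ∃ b ∈ A, a ≤ b) :
    WinsCutAndChoose (RegularOpenAlgebra (CodedSouslin S f)) := by
  set B := RegularOpenAlgebra (CodedSouslin S f)
  choose step hs1 hs2 hs3 hs4 using exists_deciding (S := S) hK hf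
  obtain ⟨γ₀, -⟩ := hS.2.1.nonempty
  have : Nonempty (CodedSouslin S f) := ⟨(exists_first_value hf γ₀).choose⟩
  choose! start hstart using fun (p : B) (hp : p ≠ ⊥) => ne_bot_iff.1 hp
  classical
  refine ⟨fun p l => decide (∃ t, l.getLast? = some t ∧
    AlmostAll U step (start p) l fun c => InRegular c t), fun p hp b => ?_⟩
  have hlast : ∀ n, (movesUpTo b n).getLast? = some (b n) := fun n => by
    rw [movesUpTo_eq, List.range'_concat]
    simp
  simp only [hlast, Option.some.injEq, exists_eq_left', decide_eq_true_eq,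
    decide_eq_false_iff_not]
  set r : ℕ → Prop := fun n => AlmostAll U step (start p) (movesUpTo b n) fun c => InRegular c (b n)
  -- `t n` is the side of the cut by `b n` that player II chooses
  let t : ℕ → B := fun n => if r n then b n else (b n)ᶜ
  have ht : ∀ n, AlmostAll U step (start p) ((List.range' 0 (n + 1)).map b)
      fun c => InRegular c (t n) := by
    intro n
    rw [← movesUpTo_eq]
    by_cases h : r n
    · simp only [t, if_pos h]
      exact h
    · simp only [t, if_neg h]
      have hdec : AlmostAll U step (start p) (movesUpTo b n)
          fun c => InRegular c (b n) ∨ InRegular c (b n)ᶜ := by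
        rw [movesUpTo_eq, List.range'_concat, List.map_append]
        simp only [List.map_cons, List.map_nil, zero_add, one_mul]
        exact AlmostAll.concat fun c ν => hs2 c (b n) ν
      exact (AlmostAll.and hdec (AlmostAll.not h)).mono fun c hc => hc.1.resolve_left hc.2
  -- from the stage `n` on, almost all continuations of the sequence that led to `c` agree with `t`
  let Good : ℕ → CodedSouslin S f → Prop := fun n c =>
    ∀ k, AlmostAll U step c ((List.range' n (k + 1)).map b) fun c => InRegular c (t (n + k))
  have hgood : ∀ n c, Good n c → ∀ᶠ ν in (U : Filter κ.ord.ToType),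
      InRegular (step c (b n) ν) (t n) ∧ Good (n + 1) (step c (b n) ν) := by
    intro n c h
    refine Filter.Eventually.and (h 0) ?_
    simp only [Good]
    rw [eventually_countable_forall]
    intro k
    have := h (k + 1)
    rw [List.range'_succ, List.map_cons, show n + (k + 1) = n + 1 + k by omega] at this
    exact this
  let X := {x : ℕ × CodedSouslin S f // Good x.1 x.2}
  have hR : ∀ (x : X) (ν : κ.ord.ToType), ∃ y : X, y.1.1 = x.1.1 + 1 ∧ y.1.2 ≤ x.1.2 ∧
      InRegular y.1.2 (t x.1.1) ∧ (∃ β, ν < y.1.2.base.g β) ∧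
      x.1.2.base.length ≤ y.1.2.base.tree.level y.1.2.node := by
    rintro ⟨⟨n, c⟩, hx⟩ ν
    obtain ⟨ν', ⟨h1, h2⟩, hν⟩ := hU' _ (hgood n c hx) ν
    obtain ⟨β, hβ⟩ := hs3 c (b n) ν'
    exact ⟨⟨⟨n + 1, step c (b n) ν'⟩, h2⟩, rfl, hs1 _ _ _, h1, ⟨β, hν.trans_lt hβ⟩, hs4 _ _ _⟩
  choose o ho using fun q : QZero S f => q.exists_bound hK
  obtain ⟨γ, ⟨-, hγS⟩, s, st, h0, hst, hsγ, hscof, hoγ⟩ := hK.exists_run hS.2.2 (fun _ h => h.1)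
    (⟨(0, start p), fun k => by simpa using ht k⟩ : X) (fun x => o x.1.2.base) hR
  have hn : ∀ n, (st n).1.1 = n := fun n => by
    induction n with
    | zero => rw [h0]
    | succ n ih => rw [(hst n).1, ih]
  obtain ⟨d, hd⟩ := exists_lower_bound (c := fun n => (st n).1.2)
    (antitone_nat_of_succ_le fun n => (hst n).2.1) (fun n => (hst n).2.2.2.2) hγS ⟨_, hsγ 0⟩
    (fun n β => (ho _ β).trans (hoγ n)) (fun a ha => by
      obtain ⟨n, hn⟩ := hscof a ha
      obtain ⟨β, hβ⟩ := (hst n).2.2.2.1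
      exact ⟨n + 1, β, hn.trans_lt hβ⟩)
  have hdt : ∀ n, principal d ≤ t n := fun n => by
    have := (hst n).2.2.1
    rw [hn n] at this
    exact principal_le_iff.2 (this.mono (hd (n + 1)))
  have hdp : principal d ≤ p := by
    have := hd 0
    simp only [h0] at this
    exact principal_le_iff.2 ((hstart p hp).mono this)
  refine ne_bot_of_le_ne_bot (principal_ne_bot d) ?_
  rw [sdiff_eq, compl_iSup]
  refine le_inf (le_inf hdp (le_iInf₂ fun n hn => ?_)) (le_iInf fun n => ?_)
  · have := hdt n
    simpa only [t, if_pos (show r n from hn)] using this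
  · rw [compl_iSup]
    refine le_iInf fun hn => ?_
    have := hdt n
    simpa only [t, if_neg (show ¬ r n from hn)] using this

end CutAndChoose

/-! ### The descending chain game -/

theorem movesUpTo_succ {B : Type*} (b : ℕ → B) (n : ℕ) :
    movesUpTo b (n + 1) = movesUpTo b n ++ [b (n + 1)] := by
  rw [movesUpTo_eq, movesUpTo_eq, List.range'_concat, List.map_append]
  simp

theorem movesUpTo_congr {B : Type*} {b b' : ℕ → B} {n : ℕ} (h : ∀ i ≤ n, b i = b' i) :
    movesUpTo b n = movesUpTo b' n := by
  rw [movesUpTo_eq, movesUpTo_eq]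
  refine List.map_congr_left fun i hi => h i ?_
  simp only [List.mem_range'_1] at hi
  omega

section DescendingChain

variable {κ : Cardinal.{u}} {S : Set κ.ord.ToType} {f : CTree.{u} → CTree.{u}}

/-- The sequence `l` consists of legal moves of player I in the descending chain game on `B` against
the strategy `σ`, and it is now the turn of player II. -/
def LegalPosition {B : Type*} [CompleteBooleanAlgebra B] (σ : List B → B) (l : List B) : Prop :=
  ∃ (b : ℕ → B) (n : ℕ), l = movesUpTo b n ∧ (∀ i ≤ n, b i ≠ ⊥) ∧
    ∀ i < n, b (i + 1) ≤ σ (movesUpTo b i)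

theorem LegalPosition.concat {B : Type*} [CompleteBooleanAlgebra B] {σ : List B → B} {l : List B}
    (h : LegalPosition σ l) {c : B} (hc : c ≠ ⊥) (hcl : c ≤ σ l) :
    LegalPosition σ (l ++ [c]) := by
  obtain ⟨b, n, rfl, h1, h2⟩ := h
  let b' : ℕ → B := fun i => if i ≤ n then b i else c
  have hb' : ∀ i ≤ n, b' i = b i := fun i hi => if_pos hi
  have hc' : b' (n + 1) = c := if_neg (by omega)
  have hm : ∀ i ≤ n, movesUpTo b' i = movesUpTo b i := fun i hi =>
    movesUpTo_congr fun j hj => hb' j (hj.trans hi)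
  refine ⟨b', n + 1, by rw [movesUpTo_succ, hm n le_rfl, hc'], fun i hi => ?_, fun i hi => ?_⟩
  · rcases Nat.le_succ_iff.1 hi with hi | rfl
    · rw [hb' i hi]
      exact h1 i hi
    · rwa [hc']
  · rw [hm i (by omega)]
    rcases (Nat.lt_succ_iff.1 hi).lt_or_eq with hi | rfl
    · rw [hb' _ hi]
      exact h2 i hi
    · rwa [hc']

variable (hK : IsRegularUncountable κ.ord.ToType) (hf : IsCoding f) (hS : IsStatCostat S)

include hK hf hS in
/-- At a position of the game at which the answer of player II contains `(q, x)`, player I has two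
moves below `(q, x)` such that the answers of player II contain incomparable nodes over the same
condition of `Q₀`. -/
theorem exists_split_moves
    {σ : List (RegularOpenAlgebra (CodedSouslin S f)) → RegularOpenAlgebra (CodedSouslin S f)}
    (hσ : ∀ l c, LegalPosition σ (l ++ [c]) → σ (l ++ [c]) ≤ c ∧ σ (l ++ [c]) ≠ ⊥)
    {l : List (RegularOpenAlgebra (CodedSouslin S f))} (hl : LegalPosition σ l) {q : QZero S f}
    {x : Omega1.{u}} (hx : InAt (σ l) q x) :
    ∃ r ≤ q, ∃ (b : Bool → RegularOpenAlgebra (CodedSouslin S f)) (y : Bool → Omega1.{u}),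
      (∀ ε, b ε ≠ ⊥ ∧ b ε ≤ σ l ∧ b ε ≤ principal ⟨q, x, hx.1⟩ ∧ InAt (σ (l ++ [b ε])) r (y ε)) ∧
      ¬ r.tree.le (y true) (y false) ∧ ¬ r.tree.le (y false) (y true) := by
  obtain ⟨q₁, hq₁, hsplit⟩ := q.exists_le_split hK hf hS.1
  obtain ⟨z, z', hz, hz', hn, hn'⟩ := hsplit x hx.1
  have hmz := (q₁.tree.mem_of_lt hz).2
  have hmz' := (q₁.tree.mem_of_lt hz').2
  have key : ∀ r ≤ q₁, ∀ (w : Omega1.{u}) (hw : w ∈ r.tree.carrier), q₁.tree.lt x w →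
      ∃ c : RegularOpenAlgebra (CodedSouslin S f), c ≠ ⊥ ∧ c ≤ σ l ∧
        c ≤ principal ⟨q, x, hx.1⟩ ∧ ∃ r' ≤ r, ∃ w', r'.tree.le w w' ∧
          InAt (σ (l ++ [c])) r' w' := by
    intro r hr w hw hxw
    have hle : (⟨r, w, hw⟩ : CodedSouslin S f) ≤ ⟨q, x, hx.1⟩ :=
      ⟨hr.trans hq₁, (QZero.endExt hr).le_of_le (Or.inr hxw)⟩
    have h1 : principal (⟨r, w, hw⟩ : CodedSouslin S f) ≤ principal ⟨q, x, hx.1⟩ :=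
      principal_le_iff.2 ((inRegular_principal _).mono hle)
    have h2 : principal (⟨r, w, hw⟩ : CodedSouslin S f) ≤ σ l := principal_le_iff.2 (hx.2.mono hle)
    obtain ⟨h3, h4⟩ := hσ _ _ (hl.concat (principal_ne_bot _) h2)
    exact ⟨_, principal_ne_bot _, h2, h1, exists_inAt_of_le_principal h4 h3⟩
  obtain ⟨c, hc1, hc2, hc3, r, hr, y, hzy, hy⟩ := key q₁ le_rfl z hmz hz
  obtain ⟨c', hc1', hc2', hc3', r', hr', y', hzy', hy'⟩ :=
    key r hr z' (QZero.mem_of_le hr hmz') hz'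
  have hzy₂ := (QZero.endExt hr').le_of_le hzy
  refine ⟨r', hr'.trans (hr.trans hq₁), fun ε => bif ε then c else c',
    fun ε => bif ε then y else y', ?_, fun h => ?_, fun h => ?_⟩
  · rintro (_ | _)
    · exact ⟨hc1', hc2', hc3', hy'⟩
    · exact ⟨hc1, hc2, hc3, hy.mono hr' (CTree.le_refl _ _)⟩
  · exact QZero.not_le_of_incomparable (hr'.trans hr) hmz hmz' hn hn'
      (CTree.le_trans hzy₂ h) hzy'
  · exact QZero.not_le_of_incomparable (hr'.trans hr) hmz hmz' hn hn'
      hzy₂ (CTree.le_trans hzy' h)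

/-- The first `n` values of `z`, the last one first. -/
def initialSegment (z : ℕ → Bool) : ℕ → List Bool
  | 0 => []
  | n + 1 => z n :: initialSegment z n

theorem initialSegment_congr {z z' : ℕ → Bool} {n : ℕ} (h : ∀ i < n, z i = z' i) :
    initialSegment z n = initialSegment z' n := by
  induction n with
  | zero => rfl
  | succ n ih => rw [initialSegment, initialSegment, h n n.lt_succ_self,
      ih fun i hi => h i (hi.trans n.lt_succ_self)]

include hK hf hS in
/-- Player II does not win the descending chain game. Against a strategy of player II a binary tree
of plays is built along a single descending sequence in `Q₀` for which the supremum of the values of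
`g` is in `S`, so that different plays produce incompatible sequences of nodes. If all of the
uncountably many plays were won by player II, then all these sequences would have upper bounds on
the level that `f` prescribes, but this level is countable. -/
theorem not_winsDescendingChain :
    ¬ WinsDescendingChain (RegularOpenAlgebra (CodedSouslin S f)) := by
  set B := RegularOpenAlgebra (CodedSouslin S f)
  rintro ⟨σ, hσ1, hσ2⟩
  have hσ : ∀ l, LegalPosition σ l → σ l ≠ ⊥ := by
    rintro _ ⟨b, n, rfl, h1, h2⟩
    exact (hσ1 b n h1 h2).2
  have hσ' : ∀ l c, LegalPosition σ (l ++ [c]) → σ (l ++ [c]) ≤ c ∧ σ (l ++ [c]) ≠ ⊥ := by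
    rintro l c ⟨b, n, hl, h1, h2⟩
    have hc : c = b n := by
      have := congrArg List.getLast? hl
      rw [movesUpTo_eq, List.range'_concat] at this
      simpa using this
    rw [hl, hc]
    exact hσ1 b n h1 h2
  -- a state is a condition together with a position of the game for each finite binary sequence
  let X := {a : QZero S f × (List Bool → List B × Omega1.{u}) //
    ∀ i, LegalPosition σ (a.2 i).1 ∧ InAt (σ (a.2 i).1) a.1 (a.2 i).2}
  have hR : ∀ (a : X) (ν : κ.ord.ToType), ∃ a' : X, a'.1.1 ≤ a.1.1 ∧ (∃ β, ν < a'.1.1.g β) ∧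
      ∀ i : List Bool, (∀ ε : Bool, ∃ c : B, (a'.1.2 (ε :: i)).1 = (a.1.2 i).1 ++ [c] ∧ c ≠ ⊥ ∧
        c ≤ σ (a.1.2 i).1 ∧ c ≤ principal ⟨a.1.1, (a.1.2 i).2, (a.2 i).2.1⟩) ∧
        ¬ a'.1.1.tree.le (a'.1.2 (true :: i)).2 (a'.1.2 (false :: i)).2 ∧
        ¬ a'.1.1.tree.le (a'.1.2 (false :: i)).2 (a'.1.2 (true :: i)).2 := by
    rintro ⟨⟨q, a⟩, ha⟩ ν
    simp only at ha
    obtain ⟨r, hr, h⟩ := QZero.exists_forall_of_dense (p := q) (ι := List Bool)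
      (Φ := fun i r => ∃ (b : Bool → B) (y : Bool → Omega1.{u}),
        (∀ ε, b ε ≠ ⊥ ∧ b ε ≤ σ (a i).1 ∧ b ε ≤ principal ⟨q, (a i).2, (ha i).2.1⟩ ∧
          InAt (σ ((a i).1 ++ [b ε])) r (y ε)) ∧
        ¬ r.tree.le (y true) (y false) ∧ ¬ r.tree.le (y false) (y true))
      (by
        rintro i r r' hr' ⟨b, y, h, hn, hn'⟩
        refine ⟨b, y, fun ε => ⟨(h ε).1, (h ε).2.1, (h ε).2.2.1,
          (h ε).2.2.2.mono hr' (CTree.le_refl _ _)⟩, ?_, ?_⟩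
        · rwa [(QZero.endExt hr').le_iff (h false).2.2.2.1]
        · rwa [(QZero.endExt hr').le_iff (h true).2.2.2.1])
      (by
        intro i q' hq'
        have hx := (ha i).2.mono hq' (CTree.le_refl _ _)
        obtain ⟨r, hr, b, y, h, hn⟩ := exists_split_moves hK hf hS hσ' (ha i).1 hx
        refine ⟨r, hr, b, y, fun ε => ⟨(h ε).1, (h ε).2.1, (h ε).2.2.1.trans ?_, (h ε).2.2.2⟩, hn⟩
        exact principal_le_iff.2 ((inRegular_principal _).mono ⟨hq', CTree.le_refl _ _⟩))
    choose b y hby hn hn' using h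
    obtain ⟨q', hq', hν⟩ := r.exists_le_lt_g hK hf ν
    let a' : List Bool → List B × Omega1.{u} := fun i => match i with
      | [] => a []
      | ε :: i => ((a i).1 ++ [b i ε], y i ε)
    refine ⟨⟨⟨q', a'⟩, ?_⟩, hq'.trans hr, hν, fun i => ⟨fun ε => ⟨b i ε, rfl, (hby i ε).1,
      (hby i ε).2.1, (hby i ε).2.2.1⟩, ?_, ?_⟩⟩
    · rintro (_ | ⟨ε, i⟩)
      · exact ⟨(ha []).1, (ha []).2.mono (hq'.trans hr) (CTree.le_refl _ _)⟩
      · exact ⟨(ha i).1.concat (hby i ε).1 (hby i ε).2.1,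
          (hby i ε).2.2.2.mono hq' (CTree.le_refl _ _)⟩
    · exact fun h => hn i (((QZero.endExt hq').le_iff (hby i false).2.2.2.1).1 h)
    · exact fun h => hn' i (((QZero.endExt hq').le_iff (hby i true).2.2.2.1).1 h)
  obtain ⟨γ₀, -⟩ := hS.2.1.nonempty
  obtain ⟨c₀, -⟩ := exists_first_value (S := S) hf γ₀
  let b₀ : B := principal c₀
  have hl₀ : LegalPosition σ [b₀] := ⟨fun _ => b₀, 0, by simp [movesUpTo],
    fun _ _ => principal_ne_bot _, fun i hi => (Nat.not_lt_zero i hi).elim⟩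
  obtain ⟨q₀, x₀, hx₀⟩ := exists_inAt (hσ _ hl₀)
  choose o ho using fun q : QZero S f => q.exists_bound hK
  obtain ⟨γ, hγS, s, st, h0, hst, hsγ, hscof, hoγ⟩ := hK.exists_run hS.2.1 (fun _ h => hS.1 h)
    (⟨(q₀, fun _ => ([b₀], x₀)), fun _ => ⟨hl₀, hx₀⟩⟩ : X) (fun a => o a.1.1) hR
  obtain ⟨w, hw1, hw2, -, hlim, hlt, hlub⟩ := QZero.exists_limit_of_cofinal
    (p := fun n => (st n).1.1) (antitone_nat_of_succ_le fun n => (hst n).1) ⟨_, hsγ 0⟩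
    (fun n β => (ho _ β).trans (hoγ n)) (fun a ha => by
      obtain ⟨n, hn⟩ := hscof a ha
      obtain ⟨β, hβ⟩ := (hst n).2.1
      exact ⟨n + 1, β, hn.trans_lt hβ⟩)
  obtain ⟨-, hfh, hfr⟩ := hf w.tree w.balanced
  have hfext : CTree.EndExt w.tree (f w.tree) := hfr
  let node : (ℕ → Bool) → ℕ → Omega1.{u} := fun z n => ((st n).1.2 (initialSegment z n)).2
  -- the play along `z` is won by player II, which yields an upper bound of its nodes
  have hplay : ∀ z : ℕ → Bool, ∃ y ∈ (f w.tree).carrier, ∀ n, (f w.tree).lt (node z n) y := by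
    intro z
    choose c hc1 hc2 hc3 hc4 using fun n => ((hst n).2.2 (initialSegment z n)).1 (z n)
    let b : ℕ → B := fun n => Nat.casesOn n b₀ c
    have hb : ∀ n, ((st n).1.2 (initialSegment z n)).1 = movesUpTo b n := by
      intro n
      induction n with
      | zero => simp [h0, movesUpTo, b]
      | succ n ih => rw [movesUpTo_succ, ← ih]; exact hc1 n
    have hwin := hσ2 b (fun i => by
      cases i with
      | zero => exact principal_ne_bot _
      | succ i => exact hc2 i) (fun i => by
      rw [← hb i]
      exact hc3 i)
    obtain ⟨q, x, hqx⟩ := exists_inAt hwin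
    obtain ⟨q', hq', hql, x', hx', hxx', hxl⟩ := QZero.exists_le_level hK hf hqx.1 w.length_lt
    have hqx' := hqx.mono hq' hxx'
    have hcomp : ∀ n, ∃ e : CodedSouslin S f, e.base ≤ q' ∧ e.base.tree.le x' e.node ∧
        e.base ≤ (st n).1.1 ∧ e.base.tree.le (node z n) e.node := by
      intro n
      have h := hqx'.of_le ((iInf_le b (n + 1)).trans (hc4 n))
      obtain ⟨e, he, he'⟩ := h.2.exists_le
      exact ⟨e, he.1, he.2, he'.1, he'.2⟩
    have hqw : q' ≤ w := hw2 q' fun n => by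
      obtain ⟨e, he1, -, he2, -⟩ := hcomp n
      exact QZero.le_of_le_of_le he1 he2 ((QZero.length_le (hw1 n)).trans hql.le)
    have hg : q'.g ⟨w.length, hql⟩ = γ := by
      refine (q'.g_continuous ⟨w.length, hql⟩ hlim).unique ?_
      convert hlub using 1
      ext a
      constructor
      · rintro ⟨⟨β, hβ⟩, hβw, rfl⟩
        exact ⟨⟨β, hβw⟩, (QZero.g_eq hqw hβ hβw).symm⟩
      · rintro ⟨⟨β, hβ⟩, rfl⟩
        exact ⟨⟨β, lt_trans (b := w.length) hβ hql⟩, hβ, QZero.g_eq hqw _ hβ⟩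
    have hcode : q'.tree.restrict (Order.succ w.length) = f w.tree := by
      have := q'.coded ⟨w.length, hql⟩ (hg ▸ hγS)
      rwa [QZero.restrict_eq hqw] at this
    obtain ⟨y, hyx, hyl⟩ := CTree.exists_le_level_eq hxl
    have hys : q'.tree.level y < Order.succ w.length := hyl ▸ Order.lt_succ _
    refine ⟨y, ?_, fun n => ?_⟩
    · rw [← hcode]
      exact ⟨CTree.mem_of_le hyx hx', hys⟩
    · rw [← hcode]
      refine ⟨?_, hys⟩
      obtain ⟨e, he1, he2, he3, he4⟩ := hcomp n
      have hnode : node z n ∈ (st n).1.1.tree.carrier := ((st n).2 _).2.1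
      have hyq := CTree.mem_of_le hyx hx'
      refine ((QZero.endExt he1).lt_iff' hyq).1 (CTree.lt_of_le_of_level_lt he4
        (CTree.le_trans ((QZero.endExt he1).le_of_le hyx) he2) ?_)
      rw [(QZero.endExt he1).level_eq hyq, hyl, (QZero.endExt he3).level_eq hnode]
      exact (QZero.level_lt_length hnode).trans_le (QZero.length_le (hw1 n))
  choose top htop htop' using hplay
  have hinj : Function.Injective fun z => (⟨top z, htop z⟩ : (f w.tree).carrier) := by
    intro z z' h
    by_contra hne
    have hex : ∃ n, z n ≠ z' n := Function.ne_iff.1 hne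
    set n := Nat.find hex with hn
    have hzn : z n ≠ z' n := Nat.find_spec hex
    have hseg : initialSegment z n = initialSegment z' n := initialSegment_congr fun i hi =>
      not_not.1 (Nat.find_min hex hi)
    have h' : top z = top z' := congrArg Subtype.val h
    have h1 : (f w.tree).le (node z (n + 1)) (top z') := h' ▸ Or.inr (htop' z (n + 1))
    have h2 : (f w.tree).le (node z' (n + 1)) (top z') := Or.inr (htop' z' (n + 1))
    have hmem : ∀ z, node z (n + 1) ∈ (st (n + 1)).1.1.tree.carrier := fun z =>
      ((st (n + 1)).2 _).2.1
    have hmem' := fun z => QZero.mem_of_le (hw1 (n + 1)) (hmem z)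
    have hdown : ∀ z z', (f w.tree).le (node z (n + 1)) (node z' (n + 1)) →
        (st (n + 1)).1.1.tree.le (node z (n + 1)) (node z' (n + 1)) := fun z z' h =>
      ((QZero.endExt (hw1 (n + 1))).le_iff (hmem z')).1 ((hfext.le_iff (hmem' z')).1 h)
    obtain ⟨hi1, hi2⟩ := ((hst n).2.2 (initialSegment z n)).2
    have hnode : node z (n + 1) = ((st (n + 1)).1.2 (z n :: initialSegment z n)).2 := rfl
    have hnode' : node z' (n + 1) = ((st (n + 1)).1.2 (z' n :: initialSegment z n)).2 := by
      rw [hseg]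
      rfl
    have hinc : ∀ ε ε' : Bool, ε ≠ ε' → ¬ (st (n + 1)).1.1.tree.le
        ((st (n + 1)).1.2 (ε :: initialSegment z n)).2
        ((st (n + 1)).1.2 (ε' :: initialSegment z n)).2 := by
      rintro (_ | _) (_ | _) hne
      exacts [(hne rfl).elim, hi2, hi1, (hne rfl).elim]
    rcases CTree.linear_le h1 h2 with h | h
    · have h := hdown z z' h
      rw [hnode, hnode'] at h
      exact hinc _ _ hzn h
    · have h := hdown z' z h
      rw [hnode, hnode'] at h
      exact hinc _ _ hzn.symm h
  have := (f w.tree).countable.to_subtype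
  have hcount : Countable (ℕ → Bool) := hinj.countable
  rw [← Cardinal.mk_le_aleph0_iff] at hcount
  simp only [mk_pi, mk_bool, prod_const, Cardinal.lift_ofNat, mk_nat, lift_aleph0] at hcount
  exact (cantor ℵ₀).not_ge hcount

end DescendingChain

end CutChoose

theorem mainTheorem8 (κ : Cardinal.{u}) (hκ : IsMeasurableCardinal κ) :
    (∃ (S : Set κ.ord.ToType) (f : CTree.{u} → CTree.{u}), IsStatCostat S ∧ IsCoding f) ∧
    ∀ (S : Set κ.ord.ToType) (f : CTree.{u} → CTree.{u}), IsStatCostat S → IsCoding f →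
      IsSigmaClosed (QZero S f) ∧
      ForcesSouslinTree S f ∧
      IsProper (RegularOpenAlgebra (CodedSouslin S f)) ∧
      density (RegularOpenAlgebra (CodedSouslin S f)) = Cardinal.lift.{u + 1} κ ∧
      WinsCutAndChoose (RegularOpenAlgebra (CodedSouslin S f)) ∧
      ¬ WinsDescendingChain (RegularOpenAlgebra (CodedSouslin S f)) := by
  have hK := hκ.isRegularUncountable
  obtain ⟨S₀, hS₀⟩ := hκ.exists_isStatCostat
  obtain ⟨f₀, hf₀⟩ := exists_isCoding.{u}
  obtain ⟨U, hU, hU'⟩ := hκ.exists_ultrafilter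
  exact ⟨⟨S₀, f₀, hS₀, hf₀⟩, fun S f hS hf => ⟨QZero.isSigmaClosed, forcesSouslinTree hK hf hS,
    isProper hK hf hS, density_eq hK hκ.isStrongPrelimit hf, winsCutAndChoose hK hf hS hU hU',
    not_winsDescendingChain hK hf hS⟩⟩
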